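/- **Model.** A network is a connected undirected graph $G=(V,E)$ with $n=|V|\ge 1$, distinct edge weights $\omega(e)\in\mathbb N$ and unique node identities $\mathrm{ID}(v)\in\mathbb N$. All nodes wake up simultaneously at round $0$. In each synchronous round every node reads the memory of each of its neighbours, together with the weight of the connecting edge, and updates its own memory. Each node stores, among other variables, a parent pointer (null at a *root*), an estimate of the identity of its root, a level and a round counter. The subgraph represented by the network consists of the edges $\{u,v\}$ such that $u$ points at $v$ or $v$ points at $u$. The *fragment* $F$ of a root $r$ is the set of nodes from which the parent pointers lead to $r$, and its level is the level stored at $r$. The memory size of a node is the number of bits of a fixed injective binary encoding of its memory (its identity and all its variables). **Algorithm ALG.** Initially every node is a root of level $0$. For $i=0,1,2,\dots$, phase $i$ consists of the rounds $11\cdot 2^i,\dots,22\cdot 2^i-1$. 1. *Counting* (rounds $11\cdot2^i$ to $15\cdot 2^i-1$). Every root sets its level to $i$ and broadcasts in its fragment a wave, with its identity and level, of time-to-live $2^{i+1}-1$, decremented at every hop; a node accepts the wave from its parent only if the parent's time-to-live is positive. From round $13\cdot 2^i$ on, the number of nodes reached is summed in the echo. The root becomes active if the count is at most $2^{i+1}-1$,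 and otherwise sets its level to $i+1$. If the echo shows that the counted nodes are all nodes of $G$ (no counted node has a neighbour not counted for the same root), the root terminates; every node whose parent has terminated terminates in the next round. Terminated nodes never change their memory. 2. *Searching* (rounds $15\cdot 2^i$ to $19\cdot2^i-1$). Each active root broadcasts a wave with its identity and level. At round $17\cdot2^i$ each node reached selects its minimum-weight edge to a neighbour with a different root-identity estimate; the minimum of these, the candidate edge $(w,x)$ of the fragment $F$ (with $w\in F$, $x\notin F$), is computed in the echo, and each node remembers which child reported its best edge. 3. *Merging* (rounds $19\cdot2^i$ to $22\cdot2^i-1$). In each active fragment the root is moved, one edge per round, along the remembered pointers to $w$. At round $22\cdot 2^i-1$, $w$ sets its parent pointer to $x$, unless $x$ is at that time the root of an active fragment with candidate edge $(x,w)$ and $\mathrm{ID}(x)<\mathrm{ID}(w)$; in that case $w$ remains a root. **Theorem.** There is an absolute constant $A$, and for every $k\in\mathbb N$ a constant $B=B(k)$, such that the execution of ALG on every network has the following properties. * (Correctness and time $O(n)$.) At every round $t\ge A\,n$ all nodes have terminated, and the subgraph represented by the parent pointers is a minimum spanning tree of $G$. * (Memory $O(\log n)$.) If every identity has at most $k(\lfloor\log_2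 n\rfloor+1)$ bits and every edge weight is at most $k\,n^k$, then at every round every node uses at most $B(\lfloor\log_2 n\rfloor+1)$ bits of memory. * (Fragments.) At every round every node belongs to the fragment of some root, and every fragment of level $j$ has at least $2^j$ nodes. Moreover, every root that has not terminated at the start of phase $i$ has level $i$ at round $11\cdot 2^i$ (so its fragment has at least $2^i$ nodes). -/

import Mathlib

namespace SyncMST

/-! ### Networks and minimum spanning trees -/

/-- A connected undirected edge-weighted network, with distinct edge weights, whose nodes carry
unique identities.  The value of `weight` off the edge set is never used. -/
structure Network (V : Type*) where
  graph : SimpleGraph V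
  connected : graph.Connected
  id : V → ℕ
  id_injective : Function.Injective id
  weight : Sym2 V → ℕ
  weight_injOn : Set.InjOn weight graph.edgeSet

/-- Total weight of a graph `T` on the vertex set of the network. -/
noncomputable def Network.totalWeight {V : Type*} (N : Network V) (T : SimpleGraph V) : ℕ :=
  ∑ᶠ e ∈ T.edgeSet, N.weight e

/-- `T` is a spanning tree of the network. -/
def Network.IsSpanningTree {V : Type*} (N : Network V) (T : SimpleGraph V) : Prop :=
  T ≤ N.graph ∧ T.IsTree

/-- `T` is a spanning tree of the network, of minimum total weight. -/
def Network.IsMST {V : Type*} (N : Network V) (T : SimpleGraph V) : Prop :=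
  N.IsSpanningTree T ∧ ∀ T', N.IsSpanningTree T' → N.totalWeight T ≤ N.totalWeight T'

/-! ### The memory of a node -/

/-- A candidate edge as it is stored at a node of a fragment: its weight, the identity of its
endpoint inside the fragment, the identity of its endpoint outside, and a pointer to the next node
on the route to that outside endpoint (the child that reported the candidate, or the outside
endpoint itself).  The order is lexicographic, with the weight first. -/
abbrev Candidate : Type := ℕ ×ₗ ℕ ×ₗ ℕ ×ₗ ℕ

namespace Candidate

def mk (weight inner outer next : ℕ) : Candidate :=
  toLex (weight, toLex (inner, toLex (outer, next)))

def weight (c : Candidate) : ℕ := (ofLex c).1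

def inner (c : Candidate) : ℕ := (ofLex (ofLex c).2).1

def outer (c : Candidate) : ℕ := (ofLex (ofLex (ofLex c).2).2).1

def next (c : Candidate) : ℕ := (ofLex (ofLex (ofLex c).2).2).2

/-- The same candidate edge, reached through the child with identity `child`. -/
def via (child : ℕ) (c : Candidate) : Candidate := mk c.weight c.inner c.outer child

end Candidate

/-- Everything that a node stores; all of it can be read by the neighbours of the node. -/
structure NodeState where
  /-- the identity of the node -/
  id : ℕ
  /-- the number of rounds performed so far -/
  clock : ℕ
  /-- the identity of the parent; `none` at a root -/
  parent : Option ℕ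
  /-- the estimate of the identity of the root of the fragment -/
  rootId : ℕ
  /-- the level (at a root), or the estimate of the level of the root of the fragment -/
  level : ℕ
  /-- the time-to-live with which the counting wave was accepted; `none` before that -/
  ttl : Option ℕ
  /-- the number of counted nodes in the subtree, echoed to the parent; `none` before the echo -/
  count : Option ℕ
  /-- part of the counting echo: no counted node of the subtree has a neighbour that has not been
  counted for the same root -/
  covers : Bool
  /-- the node is the root of an active fragment -/
  active : Bool
  /-- the searching wave has been received -/
  find : Bool
  /-- the best candidate edge known so far; `⊤` if there is none -/
  cand : WithTop Candidate
  /-- the best candidate of the subtree has been echoed to the parent -/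
  found : Bool
  /-- the node is the root, and asks the next node of the route to become the root -/
  transfer : Bool
  /-- the node has terminated -/
  done : Bool

/-- What a node reads over one of its edges: the weight of the edge and the memory of the
neighbour. -/
structure Neighbour where
  weight : ℕ
  state : NodeState

namespace NodeState

/-- The memory of the node with identity `a` at wake-up: a singleton fragment of level `0`. -/
def init (a : ℕ) : NodeState where
  id := a
  clock := 0
  parent := none
  rootId := a
  level := 0
  ttl := none
  count := none
  covers := false
  active := false
  find := false
  cand := ⊤
  found := false
  transfer := false
  done := false

/-! ### Memory size -/

/-- A self-delimiting binary code of a natural number. -/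
def natCode (k : ℕ) : List Bool :=
  k.bits.flatMap (fun b => [true, b]) ++ [false]

def optReg : Option ℕ → ℕ
  | none => 0
  | some k => k + 1

def candRegs : WithTop Candidate → List ℕ
  | none => [0, 0, 0, 0, 0]
  | some c => [1, c.weight, c.inner, c.outer, c.next]

/-- The contents of the memory of a node, as a sequence of registers. -/
def regs (s : NodeState) : List ℕ :=
  [s.id, s.clock, optReg s.parent, s.rootId, s.level, optReg s.ttl, optReg s.count,
    s.covers.toNat, s.active.toNat, s.find.toNat, s.found.toNat, s.transfer.toNat,
    s.done.toNat] ++ candRegs s.cand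

/-- The contents of the memory of a node, as a bit string. -/
def encode (s : NodeState) : List Bool := s.regs.flatMap natCode

theorem natCode_append_inj : ∀ (a b : ℕ) (l l' : List Bool),
    natCode a ++ l = natCode b ++ l' → a = b ∧ l = l' := by
  have key : ∀ (x y l l' : List Bool),
      x.flatMap (fun b => [true, b]) ++ [false] ++ l =
        y.flatMap (fun b => [true, b]) ++ [false] ++ l' → x = y ∧ l = l' := by
    intro x
    induction x with
    | nil => intro y l l' h; cases y <;> simp_all
    | cons p x ih =>
      intro y l l' h
      cases y with
      | nil => simp_all
      | cons q y =>
        simp only [List.flatMap_cons, List.cons_append, List.nil_append, List.cons.injEq,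
          true_and] at h
        obtain ⟨h1, h2⟩ := ih y l l' h.2
        exact ⟨by rw [h.1, h1], h2⟩
  intro a b l l' h
  obtain ⟨h1, h2⟩ := key _ _ _ _ h
  refine ⟨?_, h2⟩
  have hf : ∀ k : ℕ, k.bits.foldr Nat.bit 0 = k := by
    intro k
    induction k using Nat.binaryRec' with
    | zero => simp
    | bit b k h ih => rw [Nat.bits_append_bit k b h, List.foldr_cons, ih]
  rw [← hf a, ← hf b, h1]

/-- The bit string determines the contents of the memory. -/
theorem encode_injective : Function.Injective encode := by
  have key : ∀ x y : List ℕ, x.flatMap natCode = y.flatMap natCode → x = y := by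
    intro x
    induction x with
    | nil => intro y h; cases y <;> simp_all [natCode]
    | cons a x ih =>
      intro y h
      cases y with
      | nil => simp [natCode] at h
      | cons b y =>
        simp only [List.flatMap_cons] at h
        obtain ⟨h1, h2⟩ := natCode_append_inj _ _ _ _ h
        rw [h1, ih y h2]
  have opt : Function.Injective optReg := by
    rintro (_ | a) (_ | b) h <;> simp_all [optReg]
  have bool : Function.Injective Bool.toNat := by decide
  have cand : Function.Injective candRegs := by
    rintro (_ | a) (_ | b) h
    · rfl
    · simp [candRegs] at h
    · simp [candRegs] at h
    · simp only [candRegs, List.cons.injEq, true_and, and_true] at h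
      obtain ⟨h1, h2, h3, h4⟩ := h
      exact congrArg some (Prod.ext h1 (Prod.ext h2 (Prod.ext h3 h4)))
  intro s s' h
  have h := key _ _ h
  simp only [regs, List.cons_append, List.nil_append, List.cons.injEq] at h
  obtain ⟨h1, h2, h3, h4, h5, h6, h7, h8, h9, h10, h11, h12, h13, h14⟩ := h
  cases s
  cases s'
  simp only [NodeState.mk.injEq]
  exact ⟨h1, h2, opt h3, h4, h5, opt h6, opt h7, bool h8, bool h9, bool h10, cand h14, bool h11,
    bool h12, bool h13⟩

/-! ### Reading the neighbourhood -/

/-- The memory of the neighbour with identity `a`, if there is one. -/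
noncomputable def lookup (nb : Multiset Neighbour) (a : ℕ) : Option NodeState :=
  ((nb.map Neighbour.state).filter (fun u => u.id = a)).toList.head?

/-- The memory of the parent; `none` at a root. -/
noncomputable def parentState (s : NodeState) (nb : Multiset Neighbour) : Option NodeState :=
  s.parent.bind (lookup nb)

/-- The memories of the children, that is, of the neighbours that point at the node. -/
def children (s : NodeState) (nb : Multiset Neighbour) : Multiset NodeState :=
  (nb.map Neighbour.state).filter (fun u => u.parent = some s.id)

/-! ### The actions of a phase

Phase `i` occupies the rounds `11 * 2 ^ i, …, 22 * 2 ^ i - 1`. -/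

/-- Round `11 * 2 ^ i`: the variables of the previous phase are reset, every root sets its level to
`i` and posts the counting wave, with time-to-live `2 ^ (i + 1) - 1`. -/
def startPhase (i : ℕ) (s : NodeState) : NodeState :=
  let s : NodeState := { s with
    ttl := none, count := none, covers := false, active := false, find := false, cand := ⊤,
    found := false, transfer := false }
  if s.parent = none then
    { s with rootId := s.id, level := i, ttl := some (2 ^ (i + 1) - 1) }
  else s

/-- The counting wave: a node accepts it from its parent if the time-to-live of the parent is above
zero, and decrements the time-to-live. -/
noncomputable def countWave (s : NodeState) (nb : Multiset Neighbour) : NodeState :=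
  if s.ttl = none then
    match s.parentState nb with
    | none => s
    | some p =>
      match p.ttl with
      | some (τ + 1) => { s with ttl := some τ, rootId := p.rootId, level := p.level }
      | _ => s
  else s

/-- The counting echo.  A node that was counted echoes once all its children have echoed; a node
with time-to-live zero is a leaf of the wave.  When the echo terminates at the root, the root
becomes active if the count is at most `2 ^ (i + 1) - 1`, and sets its level to `i + 1` otherwise;
if the count covers the whole graph, the root terminates. -/
def countEcho (i : ℕ) (s : NodeState) (nb : Multiset Neighbour) : NodeState :=
  let ch : Multiset NodeState := if s.ttl = some 0 then 0 else s.children nb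
  if s.ttl ≠ none ∧ s.count = none ∧ ∀ u ∈ ch, u.count ≠ none then
    let total : ℕ := 1 + (ch.map (fun u => u.count.getD 0)).sum
    let covers : Bool := decide
      ((∀ u ∈ nb.map Neighbour.state, u.ttl ≠ none ∧ u.rootId = s.rootId) ∧
        ∀ u ∈ ch, u.covers = true)
    let s : NodeState := { s with count := some total, covers := covers }
    if s.parent = none then
      if total ≤ 2 ^ (i + 1) - 1 then { s with active := true, done := covers }
      else { s with level := i + 1, done := covers }
    else s
  else s

/-- Round `15 * 2 ^ i`: every active root posts the searching wave. -/
def startFind (s : NodeState) : NodeState :=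
  if s.active then { s with find := true } else s

/-- The searching wave, which carries the identity and the level of the root. -/
noncomputable def findWave (s : NodeState) (nb : Multiset Neighbour) : NodeState :=
  match s.parentState nb with
  | none => s
  | some p =>
    if p.find then { s with find := true, rootId := p.rootId, level := p.level } else s

/-- Round `17 * 2 ^ i`: every node that has received the searching wave finds the minimum edge that
leads to a neighbour with another estimate of the identity of the root. -/
def findLocal (s : NodeState) (nb : Multiset Neighbour) : NodeState :=
  if s.find then
    { s with
      cand := ((nb.filter (fun x => x.state.rootId ≠ s.rootId)).map (fun x =>
        ((Candidate.mk x.weight s.id x.state.id x.state.id : Candidate) :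
          WithTop Candidate))).inf }
  else s

/-- The searching echo: once all its children have echoed, a node echoes the minimum of its own
candidate and the candidates of its children. -/
def findEcho (s : NodeState) (nb : Multiset Neighbour) : NodeState :=
  if s.find = true ∧ s.found = false ∧ ∀ u ∈ s.children nb, u.found = true then
    { s with
      found := true
      cand := s.cand ⊓
        ((s.children nb).map (fun u => WithTop.map (Candidate.via u.id) u.cand)).inf }
  else s

/-- The node is on the route to the candidate edge of its fragment, but is not its endpoint. -/
def mustTransfer (s : NodeState) : Bool :=
  match s.cand with
  | none => false
  | some c => c.inner != s.id

/-- Round `19 * 2 ^ i`: an active root which is not the endpoint of the candidate edge starts the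
root transfer. -/
def startTransfer (s : NodeState) : NodeState :=
  if s.active then { s with transfer := s.mustTransfer } else s

/-- The root transfer over one edge.  In the same round, the root `p` that asked for the transfer
points at the next node of the route, and that node becomes the root of the active fragment; it asks
for a further transfer if it is not the endpoint of the candidate edge. -/
noncomputable def rootTransfer (s : NodeState) (nb : Multiset Neighbour) : NodeState :=
  if s.transfer then
    match s.cand with
    | none => s
    | some c => { s with parent := some c.next, active := false, transfer := false }
  else
    match s.parentState nb with
    | none => s
    | some p =>
      match p.cand with
      | none => s
      | some c =>
        if p.transfer = true ∧ c.next = s.id then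
          { s with parent := none, active := true, transfer := s.mustTransfer }
        else s

/-- Seen from the endpoint with memory `s` of the candidate edge `(s, x)`: the node `s` is, at this
time, the pivot of the fragment of `x`, where `x` is the endpoint of the candidate edge of its own
fragment, to the root of which it has been made. -/
def isPivotOf (s x : NodeState) : Bool :=
  match x.cand with
  | none => false
  | some c => x.active && c.inner == x.id && c.outer == s.id

/-- Round `22 * 2 ^ i - 1`: the endpoint `s` of the candidate edge `(s, x)` of an active fragment,
which is now the root of that fragment, hooks upon `x`, unless `s` is at this time a pivot of the
fragment of `x` and `x` has the smaller identity. -/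
noncomputable def hook (s : NodeState) (nb : Multiset Neighbour) : NodeState :=
  if s.active then
    match s.cand with
    | none => s
    | some c =>
      match lookup nb c.outer with
      | none => s
      | some x =>
        if s.isPivotOf x = true ∧ x.id < s.id then s else { s with parent := some x.id }
  else s

/-- One round of the algorithm at a node with memory `s`, whose neighbourhood reads `nb`.  A node
whose parent has terminated terminates.  The phase is computed from the round number. -/
noncomputable def step (s : NodeState) (nb : Multiset Neighbour) : NodeState :=
  if s.done then s
  else
    let t := s.clock + 1
    let i := Nat.log 2 (t / 11)
    let P := 2 ^ i
    let s : NodeState := { s with clock := t }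
    if (s.parentState nb).any (fun p => p.done) then { s with done := true }
    else if t < 11 then s
    else if t = 11 * P then s.startPhase i
    else if t < 13 * P then s.countWave nb
    else if t < 15 * P then s.countEcho i nb
    else if t = 15 * P then s.startFind
    else if t < 17 * P then s.findWave nb
    else if t = 17 * P then s.findLocal nb
    else if t < 19 * P then s.findEcho nb
    else if t = 19 * P then s.startTransfer
    else if t < 22 * P - 1 then s.rootTransfer nb
    else s.hook nb

end NodeState

/-! ### Executions -/

section Execution

variable {V : Type*} [Fintype V] (N : Network V)

open Classical in
/-- What the node `v` reads when the memories of the nodes are given by `σ`. -/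
noncomputable def Network.view (σ : V → NodeState) (v : V) : Multiset Neighbour :=
  (N.graph.neighborFinset v).val.map (fun u => ⟨N.weight s(v, u), σ u⟩)

/-- The memories of all nodes after round `t` of the synchronous execution in which all nodes wake
up simultaneously at round `0`. -/
noncomputable def Network.run : ℕ → V → NodeState
  | 0 => fun v => NodeState.init (N.id v)
  | t + 1 => fun v => (Network.run t v).step (N.view (Network.run t) v)

/-- The subgraph represented after round `t`: an edge belongs to it if and only if at least one of
its endpoints points at the other. -/
def Network.output (t : ℕ) : SimpleGraph V :=
  SimpleGraph.fromRel (fun v u => (N.run t v).parent = some (N.id u))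

/-- The node `r` is a root after round `t`. -/
def Network.IsRoot (t : ℕ) (r : V) : Prop := (N.run t r).parent = none

/-- The fragment of `r` after round `t`: the nodes from which the parent pointers lead to `r`. -/
def Network.fragment (t : ℕ) (r : V) : Set V :=
  {v | Relation.ReflTransGen (fun a b => (N.run t a).parent = some (N.id b)) v r}

/-- The number of bits in the memory of the node `v` after round `t`. -/
noncomputable def Network.memory (t : ℕ) (v : V) : ℕ := (N.run t v).encode.length

end Execution

end SyncMST

/-! Correctness rests on the cut property. An edge is light if it is the cheapest edge leaving some
set of nodes. Weights are distinct, so a spanning tree that lacks a light edge can be improved by an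
exchange; hence a spanning tree consisting of light edges is minimum
(`IsSpanningTree.isMST_of_light`). Every pointer set by the algorithm follows the candidate edge of
a tree, which is light, or reverses an earlier pointer.

The invariant `PhaseStart` says that just before phase `i` the pointers form a forest of light edges
whose trees have at least `2 ^ i` nodes. Put `M = 2 ^ (i + 1) - 1`. The counting wave sees only
depths up to `M`, but a tree with a node of depth `M` or more has more than `M` nodes among these
depths. So the truncated count decides whether the tree has at most `M` nodes
(`Forest.card_sub_le_iff`), and such a small tree has depth less than `M`, so that its search and
its root transfer fit into their rounds. Each small tree finds its minimum outgoing edge, moves its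
root to the inner endpoint and hooks. Along consecutive hooks the candidate weights decrease, except
when two trees choose the same edge, and then the identities forbid one of the two hooks; hence no
cycle arises. A root that survives belongs to a tree that was already large, or to a pair of trees
with a common candidate edge, which have `2 * 2 ^ i` nodes together (`Searched.exists_hooked`). This
gives the invariant for `i + 1`.

Since `2 ^ i ≤ n` at every such start, some phase must end otherwise, namely with a root whose count
covers the network. The termination then runs down a tree of depth at most `M` before any later
action can change the pointers (`run_of_covers`), and everything is over before round `22 * n`.
Until then all registers hold identities, weights or numbers linear in `n`; afterwards they are
frozen.

The execution is controlled by closed forms for all memories after each round (`waveState`,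
`echoState`, `findState`, `transferState`), verified by induction on the round. -/

namespace SyncMST

/-! ### Light edges and minimum spanning trees -/

namespace Network

variable {V : Type*} (N : Network V)

/-- The edge `{a, b}` has minimum weight among the edges that leave some set of nodes. -/
def Light (a b : V) : Prop :=
  ∃ S : Set V, a ∈ S ∧ b ∉ S ∧
    ∀ a' ∈ S, ∀ b' ∉ S, N.graph.Adj a' b' → N.weight s(a, b) ≤ N.weight s(a', b')

variable {N}

theorem Light.symm {a b : V} (h : N.Light a b) : N.Light b a := by
  obtain ⟨S, ha, hb, h⟩ := h
  refine ⟨Sᶜ, hb, by simpa using ha, fun a' ha' b' hb' hab => ?_⟩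
  have := h b' (by simpa using hb') a' ha' hab.symm
  rwa [Sym2.eq_swap, Sym2.eq_swap (a := a')]

/-- A spanning tree without some light edge is not minimum. -/
theorem IsSpanningTree.exchange [Finite V] {T : SimpleGraph V} (hT : N.IsSpanningTree T) {u v : V}
    (huv : N.graph.Adj u v) (hl : N.Light u v) (hn : ¬ T.Adj u v) :
    ∃ T', N.IsSpanningTree T' ∧ N.totalWeight T' < N.totalWeight T := by
  classical
  obtain ⟨S, hu, hv, hmin⟩ := hl
  obtain ⟨p, hp, -⟩ := hT.2.existsUnique_path u v
  -- The tree path from `u` to `v` leaves `S` over some edge `ab`, which will be exchanged for `uv`.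
  obtain ⟨d, hd, hd1, hd2⟩ := p.exists_boundary_dart S hu hv
  obtain ⟨⟨a, b⟩, hab⟩ := d
  simp only at hd1 hd2 hab
  have hf : s(a, b) ∈ p.edges := List.mem_map.2 ⟨_, hd, rfl⟩
  set D : SimpleGraph V := T.deleteEdges {s(a, b)} with hD
  have hDT : D ≤ T := T.deleteEdges_le _
  -- A path from `u` to `v` avoiding `ab` would be `p`, by uniqueness of paths in `T`; but `p` uses
  -- `ab`.
  have hnr : ¬ D.Reachable u v := by
    rintro ⟨q⟩
    have hq : (q.toPath : D.Walk u v).IsPath := q.toPath.2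
    have := (hT.2.isAcyclic.subsingleton_path u v).elim ⟨p, hp⟩
      ⟨(q.toPath : D.Walk u v).mapLe hDT, hq.mapLe hDT⟩
    have hpq : p = (q.toPath : D.Walk u v).mapLe hDT := congrArg Subtype.val this
    rw [hpq, SimpleGraph.Walk.edges_mapLe_eq_edges] at hf
    have := SimpleGraph.Walk.edges_subset_edgeSet _ hf
    simp [hD, SimpleGraph.edgeSet_deleteEdges] at this
  have hac : (D ⊔ SimpleGraph.edge u v).IsAcyclic :=
    (hT.2.isAcyclic.anti hDT).sup_edge_of_not_reachable hnr
  have hne : u ≠ v := huv.ne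
  have hDe : D.edgeSet = T.edgeSet \ {s(a, b)} := SimpleGraph.edgeSet_deleteEdges _
  have hE : (D ⊔ SimpleGraph.edge u v).edgeSet = insert s(u, v) D.edgeSet := by
    ext e; simp only [SimpleGraph.edgeSet_sup, SimpleGraph.edgeSet_edge]; grind [Sym2.mem_diagSet, Sym2.mk_isDiag_iff]
  have hTe : T.edgeSet = insert s(a, b) D.edgeSet := by
    rw [hDe, Set.insert_sdiff_singleton, Set.insert_eq_of_mem]
    exact hab
  have h1 : s(u, v) ∉ D.edgeSet := fun h => hn (hDT h)
  have h2 : s(a, b) ∉ D.edgeSet := by simp [hDe]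
  have hfin : D.edgeSet.Finite := Set.toFinite _
  -- Connectedness of `D` plus `uv` is obtained indirectly: extend it to a spanning tree `F`, and
  -- compare numbers of edges to see that nothing was added.
  obtain ⟨F, hF1, hF2, hF3⟩ := N.connected.exists_isTree_le_of_le_of_isAcyclic
    (H := D ⊔ SimpleGraph.edge u v) (sup_le (hDT.trans hT.1) (by
      rw [SimpleGraph.edge_le]; rintro _ ⟨rfl, -⟩; exact huv)) hac
  have hFe : (D ⊔ SimpleGraph.edge u v).edgeSet = F.edgeSet := by
    refine Set.eq_of_subset_of_ncard_le (SimpleGraph.edgeSet_mono hF1) ?_ (Set.toFinite _)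
    have c1 := (SimpleGraph.isTree_iff_connected_and_card.1 hF3).2
    have c2 := (SimpleGraph.isTree_iff_connected_and_card.1 hT.2).2
    rw [Nat.card_coe_set_eq] at c1 c2
    rw [hE, Set.ncard_insert_of_notMem h1 hfin]
    rw [hTe, Set.ncard_insert_of_notMem h2 hfin] at c2
    omega
  refine ⟨F, ⟨hF2, hF3⟩, ?_⟩
  unfold totalWeight
  rw [← hFe, hE, hTe, finsum_mem_insert _ h1 hfin, finsum_mem_insert _ h2 hfin]
  have hle := hmin a hd1 b hd2 (hT.1 hab)
  -- Equal weights would mean `uv = ab`, but `ab` lies in `T` and `uv` does not.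
  have hlt : N.weight s(u, v) ≠ N.weight s(a, b) := by
    intro h
    have := N.weight_injOn (SimpleGraph.mem_edgeSet _ |>.2 huv)
      (SimpleGraph.mem_edgeSet _ |>.2 (hT.1 hab)) h
    apply hn
    rw [← SimpleGraph.mem_edgeSet, this]
    exact hab
  have := lt_of_le_of_ne hle hlt
  omega

/-- A spanning tree all of whose edges are light is a minimum spanning tree. -/
theorem IsSpanningTree.isMST_of_light [Finite V] {T : SimpleGraph V} (hT : N.IsSpanningTree T)
    (hl : ∀ u v, T.Adj u v → N.Light u v) : N.IsMST T := by
  classical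
  refine ⟨hT, ?_⟩
  obtain ⟨M, hM, hmin⟩ : ∃ M, N.IsSpanningTree M ∧
      ∀ T', N.IsSpanningTree T' → N.totalWeight M ≤ N.totalWeight T' := by
    obtain ⟨M, hM, h⟩ := WellFounded.has_min
      (InvImage.wf (fun T' : SimpleGraph V => N.totalWeight T') wellFounded_lt)
      {T' | N.IsSpanningTree T'} ⟨T, hT⟩
    exact ⟨M, hM, fun T' h' => not_lt.1 (h T' h')⟩
  -- By exchange, the minimum spanning tree `M` contains every edge of `T`. Spanning trees have
  -- equally many edges, so `T = M`.
  have hTM : T ≤ M := by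
    intro u v huv
    by_contra hn
    obtain ⟨T', h', hlt⟩ := hM.exchange (hT.1 huv) (hl u v huv) hn
    exact absurd (hmin T' h') (not_le.2 hlt)
  have : T.edgeSet = M.edgeSet := by
    refine Set.eq_of_subset_of_ncard_le (SimpleGraph.edgeSet_mono hTM) ?_ (Set.toFinite _)
    have c1 := (SimpleGraph.isTree_iff_connected_and_card.1 hM.2).2
    have c2 := (SimpleGraph.isTree_iff_connected_and_card.1 hT.2).2
    rw [Nat.card_coe_set_eq] at c1 c2
    omega
  rw [SimpleGraph.edgeSet_injective this]
  exact hmin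

end Network

end SyncMST

namespace SyncMST

/-! ### Forests -/

/-- A rooted forest in the network, given by parent pointers, with the depth and the root of every
node. -/
structure Forest {V : Type*} (N : Network V) where
  par : V → Option V
  dep : V → ℕ
  rt : V → V
  adj : ∀ {v u}, par v = some u → N.graph.Adj v u
  dep_root : ∀ {v}, par v = none → dep v = 0
  rt_root : ∀ {v}, par v = none → rt v = v
  dep_child : ∀ {v u}, par v = some u → dep v = dep u + 1
  rt_child : ∀ {v u}, par v = some u → rt v = rt u

namespace Forest

variable {V : Type*} {N : Network V} (F : Forest N)

/-- `u` is a descendant of `v`. -/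
def Desc (u v : V) : Prop := Relation.ReflTransGen (fun a b => F.par a = some b) u v

variable {F}

theorem Desc.refl (v : V) : F.Desc v v := Relation.ReflTransGen.refl

theorem Desc.rt_eq {u v : V} (h : F.Desc u v) : F.rt u = F.rt v := by
  induction h with
  | refl => rfl
  | tail _ h ih => rw [ih, F.rt_child h]

theorem Desc.dep_le {u v : V} (h : F.Desc u v) : F.dep v ≤ F.dep u := by
  induction h with
  | refl => rfl
  | tail _ h ih => have := F.dep_child h; omega

theorem Desc.eq_or_lt {u v : V} (h : F.Desc u v) : u = v ∨ F.dep v < F.dep u := by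
  cases h with
  | refl => exact Or.inl rfl
  | tail h1 h =>
    have := F.dep_child h
    have : F.dep _ ≤ F.dep _ := Desc.dep_le h1
    right; omega

theorem Desc.parent {u v c : V} (h : F.Desc u c) (hc : F.par c = some v) : F.Desc u v :=
  Relation.ReflTransGen.tail h hc

theorem Desc.eq_or_child {u v : V} (h : F.Desc u v) :
    u = v ∨ ∃ c, F.par c = some v ∧ F.Desc u c := by
  cases h with
  | refl => exact Or.inl rfl
  | tail h1 h => exact Or.inr ⟨_, h, h1⟩

/-- Pointers are deterministic, so two ancestors of a node are comparable, and depth is strictly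
monotone along pointers. This is what makes the subtrees of siblings disjoint. -/
theorem Desc.eq_of_dep_eq {u a b : V} (ha : F.Desc u a) (hb : F.Desc u b)
    (h : F.dep a = F.dep b) : a = b := by
  have hU : Relator.RightUnique (fun a b => F.par a = some b) := by
    intro x y z hy hz
    exact Option.some_injective _ (hy.symm.trans hz)
  rcases Relation.ReflTransGen.total_of_right_unique hU ha hb with h1 | h1
  · rcases Desc.eq_or_lt (F := F) h1 with h2 | h2
    · exact h2
    · omega
  · rcases Desc.eq_or_lt (F := F) h1 with h2 | h2
    · exact h2.symm
    · omega

variable (F)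

theorem desc_rt (v : V) : F.Desc v (F.rt v) := by
  induction hd : F.dep v generalizing v with
  | zero =>
    cases hp : F.par v with
    | none => rw [F.rt_root hp]; exact Desc.refl v
    | some u => have := F.dep_child hp; omega
  | succ d ih =>
    cases hp : F.par v with
    | none => have := F.dep_root hp; omega
    | some u =>
      have := F.dep_child hp
      rw [F.rt_child hp]
      exact Relation.ReflTransGen.head hp (ih u (by omega))

theorem par_rt (v : V) : F.par (F.rt v) = none := by
  induction hd : F.dep v generalizing v with
  | zero =>
    cases hp : F.par v with
    | none => rw [F.rt_root hp]; exact hp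
    | some u => have := F.dep_child hp; omega
  | succ d ih =>
    cases hp : F.par v with
    | none => have := F.dep_root hp; omega
    | some u =>
      have := F.dep_child hp
      rw [F.rt_child hp]
      exact ih u (by omega)

theorem rt_rt (v : V) : F.rt (F.rt v) = F.rt v := F.rt_root (F.par_rt v)

theorem desc_root_iff {u r : V} (hr : F.par r = none) : F.Desc u r ↔ F.rt u = r := by
  constructor
  · intro h; rw [h.rt_eq, F.rt_root hr]
  · rintro rfl; exact F.desc_rt u

theorem dep_eq_zero_iff {v : V} : F.dep v = 0 ↔ F.par v = none := by
  refine ⟨fun h => ?_, F.dep_root⟩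
  cases hp : F.par v with
  | none => rfl
  | some u => have := F.dep_child hp; omega

/-- A function that is constant along the pointers is determined by its values at the roots. -/
theorem apply_rt {α : Type*} (f : V → α) (hf : ∀ v u, F.par v = some u → f v = f u) (v : V) :
    f (F.rt v) = f v := by
  have key : ∀ u, F.Desc v u → f u = f v := by
    intro u h
    induction h with
    | refl => rfl
    | tail _ h ih => rw [← ih, hf _ _ h]
  exact key _ (F.desc_rt v)

/-- Parent pointers along which some rank decreases form a forest. -/
theorem exists_of_rank (par : V → Option V) (rank : V → ℕ)
    (h : ∀ v u, par v = some u → N.graph.Adj v u ∧ rank u < rank v) :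
    ∃ F : Forest N, F.par = par := by
  -- Following the pointers from `v` gives a path `l` of `d` steps to a root `r`; it ends because
  -- the rank decreases.
  have key : ∀ n v, rank v < n → ∃ d r, ∃ l : ℕ → V, l 0 = v ∧ l d = r ∧
      (∀ k < d, par (l k) = some (l (k + 1))) ∧ par r = none := by
    intro n
    induction n with
    | zero => intro v hv; omega
    | succ n ih =>
      intro v hv
      cases hp : par v with
      | none => exact ⟨0, v, fun _ => v, rfl, rfl, by simp, hp⟩
      | some u =>
        obtain ⟨d, r, l, h0, hd, hl, hr⟩ := ih u (by have := (h v u hp).2; omega)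
        refine ⟨d + 1, r, fun k => Nat.casesOn k v l, rfl, hd, ?_, hr⟩
        rintro (_ | k) hk
        · simpa [h0] using hp
        · exact hl k (by omega)
  -- Length and end of this path depend on its start only, so they can serve as depth and root.
  have uniq : ∀ (d d' : ℕ) (l l' : ℕ → V), l 0 = l' 0 → (∀ k < d, par (l k) = some (l (k + 1))) →
      (∀ k < d', par (l' k) = some (l' (k + 1))) → par (l d) = none → par (l' d') = none →
      d = d' ∧ l d = l' d' := by
    intro d d' l l' h0 hl hl' hr hr'
    have agree : ∀ k, k ≤ d → k ≤ d' → l k = l' k := by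
      intro k
      induction k with
      | zero => intros; exact h0
      | succ k ih =>
        intro h1 h2
        have e1 := hl k (by omega)
        rw [ih (by omega) (by omega), hl' k (by omega)] at e1
        exact (Option.some_injective _ e1).symm
    rcases lt_trichotomy d d' with hlt | rfl | hlt
    · have := hl' d hlt
      rw [← agree d le_rfl hlt.le, hr] at this
      simp at this
    · exact ⟨rfl, agree d le_rfl le_rfl⟩
    · have := hl d' hlt
      rw [agree d' hlt.le le_rfl, hr'] at this
      simp at this
  choose d r l h0 hd hl hr using fun v => key (rank v + 1) v (by omega)
  have step : ∀ v u, par v = some u → d v = d u + 1 ∧ r v = r u := by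
    intro v u hp
    -- The path of `v` is compared with the path of `u` with `v` put in front.
    have := uniq (d v) (d u + 1) (l v) (fun k => Nat.casesOn k v (l u)) (h0 v) (hl v)
      (by
        rintro (_ | k) hk
        · simpa [h0] using hp
        · exact hl u k (by omega)) (by rw [hd, hr]) (by simp [hd, hr])
    simpa [hd] using this
  have root : ∀ v, par v = none → d v = 0 ∧ r v = v := by
    intro v hp
    have := uniq (d v) 0 (l v) (fun _ => v) (h0 v) (hl v) (by simp) (by rw [hd, hr]) hp
    simpa [hd] using this
  exact ⟨⟨par, d, r, fun hp => (h _ _ hp).1, fun hp => (root _ hp).1, fun hp => (root _ hp).2,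
    fun hp => (step _ _ hp).1, fun hp => (step _ _ hp).2⟩, rfl⟩

theorem exists_singletons (N : Network V) : ∃ F : Forest N, ∀ v, F.par v = none ∧ F.rt v = v :=
  ⟨⟨fun _ => none, fun _ => 0, fun v => v, by simp, by simp, by simp, by simp, by simp⟩,
    fun _ => ⟨rfl, rfl⟩⟩

open Classical in
/-- The children of `v` in the forest. -/
noncomputable def ch [Fintype V] (F : Forest N) (v : V) : Finset V :=
  Finset.univ.filter (fun u => F.par u = some v)

theorem mem_ch [Fintype V] {F : Forest N} {u v : V} : u ∈ F.ch v ↔ F.par u = some v := by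
  simp [ch]

/-- The number of nodes in the tree of `v`. -/
noncomputable def size (v : V) : ℕ := Set.ncard {u | F.rt u = F.rt v}

theorem size_pos [Finite V] (v : V) : 0 < F.size v := (Set.ncard_pos (Set.toFinite _)).2 ⟨v, rfl⟩

theorem size_le_card [Fintype V] (v : V) : F.size v ≤ Fintype.card V := by
  rw [← Nat.card_eq_fintype_card, ← Set.ncard_univ]
  exact Set.ncard_le_ncard (Set.subset_univ _) (Set.toFinite _)

/-- The configuration `σ` stores the identities of the nodes and the pointers of the forest. -/
def Rep (σ : V → NodeState) : Prop :=
  ∀ v, (σ v).id = N.id v ∧ (σ v).parent = (F.par v).map N.id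

variable {F}

theorem Rep.parent_eq_some {σ : V → NodeState} (h : F.Rep σ) {u v : V} :
    (σ u).parent = some (N.id v) ↔ F.par u = some v := by
  rw [(h u).2]
  cases F.par u with
  | none => simp
  | some w => simp [N.id_injective.eq_iff]

theorem Rep.parent_eq_none {σ : V → NodeState} (h : F.Rep σ) {u : V} :
    (σ u).parent = none ↔ F.par u = none := by
  rw [(h u).2]; simp

end Forest

/-- The clock is set to `c`. -/
def NodeState.tick (s : NodeState) (c : ℕ) : NodeState := { s with clock := c }

/-! ### Reading the neighbourhood -/

namespace Network

variable {V : Type*} [Fintype V] {N : Network V}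

theorem mem_view {σ : V → NodeState} {v : V} {x : Neighbour} :
    x ∈ N.view σ v ↔ ∃ u, N.graph.Adj v u ∧ (⟨N.weight s(v, u), σ u⟩ : Neighbour) = x := by
  simp [view]

theorem mem_of_lookup {nb : Multiset Neighbour} {a : ℕ} {s : NodeState}
    (h : NodeState.lookup nb a = some s) : s.id = a ∧ ∃ x ∈ nb, x.state = s := by
  unfold NodeState.lookup at h
  have := List.mem_of_mem_head? h
  simpa [and_comm] using this

/-- Identities are distinct, so the filter leaves a single neighbour and the order chosen by
`toList` is irrelevant. -/
theorem lookup_view {σ : V → NodeState} (hid : ∀ v, (σ v).id = N.id v) {u v : V}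
    (h : N.graph.Adj v u) : NodeState.lookup (N.view σ v) (N.id u) = some (σ u) := by
  have : ((N.view σ v).map Neighbour.state).filter (fun w => w.id = N.id u) = {σ u} := by
    classical
    unfold view
    rw [Multiset.map_map, Multiset.filter_map]
    have : Multiset.filter ((fun w : NodeState => w.id = N.id u) ∘
        (Neighbour.state ∘ fun u => ⟨N.weight s(v, u), σ u⟩)) (N.graph.neighborFinset v).val
        = {u} := by
      rw [← Finset.filter_val, ← Finset.singleton_val]
      congr 1
      ext w
      simp only [Function.comp, hid, N.id_injective.eq_iff, Finset.mem_filter,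
        SimpleGraph.mem_neighborFinset, Finset.mem_singleton]
      constructor
      · exact And.right
      · rintro rfl; exact ⟨h, rfl⟩
    rw [this]; rfl
  unfold NodeState.lookup
  rw [this]
  simp

variable {F : Forest N} {σ : V → NodeState}

theorem children_eq (h : F.Rep σ) (v : V) (s : NodeState) (hs : s.id = N.id v) :
    s.children (N.view σ v) = (F.ch v).val.map σ := by
  classical
  unfold NodeState.children view Forest.ch
  rw [Multiset.map_map, Multiset.filter_map, hs, Finset.filter_val]
  have : Multiset.filter ((fun u : NodeState => u.parent = some (N.id v)) ∘
        (Neighbour.state ∘ fun u => ⟨N.weight s(v, u), σ u⟩)) (N.graph.neighborFinset v).val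
      = (F.ch v).val := by
    unfold Forest.ch
    rw [← Finset.filter_val]
    congr 1
    ext w
    simp only [Function.comp, Finset.mem_filter, h.parent_eq_some, Finset.mem_univ, true_and,
      SimpleGraph.mem_neighborFinset, and_iff_right_iff_imp]
    exact fun hw => (F.adj hw).symm
  rw [this]
  rfl

theorem parentState_eq (h : F.Rep σ) (v : V) (s : NodeState) (hs : s.parent = (σ v).parent) :
    s.parentState (N.view σ v) = (F.par v).map σ := by
  unfold NodeState.parentState
  rw [hs, (h v).2]
  cases hp : F.par v with
  | none => rfl
  | some u => simpa using lookup_view (fun v => (h v).1) (F.adj hp)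

/-- Nobody has terminated after round `t`. -/
def Live (N : Network V) (t : ℕ) : Prop :=
  ∀ v, (N.run t v).done = false ∧ (N.run t v).clock = t

theorem run_succ_of_done {t : ℕ} {v : V} (h : (N.run t v).done = true) :
    N.run (t + 1) v = N.run t v := by
  show (N.run t v).step _ = _
  simp [NodeState.step, h]

-- Stated for a single node, so that it also applies to nodes not yet reached by a termination that
-- has begun elsewhere.
open NodeState in
theorem run_succ_of_not_done {t i : ℕ} {v : V} (hd : (N.run t v).done = false)
    (hc : (N.run t v).clock = t)
    (hpar : ((N.run t v).parentState (N.view (N.run t) v)).any (fun p => p.done) = false)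
    (h1 : 11 * 2 ^ i ≤ t + 1) (h2 : t + 1 < 22 * 2 ^ i) :
    N.run (t + 1) v =
      let s : NodeState := (N.run t v).tick (t + 1)
      let nb := N.view (N.run t) v
      let P := 2 ^ i
      if t + 1 = 11 * P then s.startPhase i
      else if t + 1 < 13 * P then s.countWave nb
      else if t + 1 < 15 * P then s.countEcho i nb
      else if t + 1 = 15 * P then s.startFind
      else if t + 1 < 17 * P then s.findWave nb
      else if t + 1 = 17 * P then s.findLocal nb
      else if t + 1 < 19 * P then s.findEcho nb
      else if t + 1 = 19 * P then s.startTransfer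
      else if t + 1 < 22 * P - 1 then s.rootTransfer nb
      else s.hook nb := by
  show (N.run t v).step _ = _
  have hP : 0 < 2 ^ i := by positivity
  have hlog : Nat.log 2 ((t + 1) / 11) = i := by
    apply Nat.log_eq_of_pow_le_of_lt_pow
    · rw [Nat.le_div_iff_mul_le (by norm_num)]; omega
    · rw [Nat.div_lt_iff_lt_mul (by norm_num), pow_succ]; omega
  have hpar' : Option.any (fun p => p.done)
      (parentState { N.run t v with clock := t + 1 } (N.view (N.run t) v)) = false := hpar
  unfold step
  rw [if_neg (by simp [hd])]
  simp only [hc, hlog]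
  rw [hpar', if_neg (by simp), if_neg (by omega)]
  rfl

theorem run_succ_of_live {t i : ℕ} (h : N.Live t) (v : V) (h1 : 11 * 2 ^ i ≤ t + 1)
    (h2 : t + 1 < 22 * 2 ^ i) :
    N.run (t + 1) v =
      let s : NodeState := (N.run t v).tick (t + 1)
      let nb := N.view (N.run t) v
      let P := 2 ^ i
      if t + 1 = 11 * P then s.startPhase i
      else if t + 1 < 13 * P then s.countWave nb
      else if t + 1 < 15 * P then s.countEcho i nb
      else if t + 1 = 15 * P then s.startFind
      else if t + 1 < 17 * P then s.findWave nb
      else if t + 1 = 17 * P then s.findLocal nb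
      else if t + 1 < 19 * P then s.findEcho nb
      else if t + 1 = 19 * P then s.startTransfer
      else if t + 1 < 22 * P - 1 then s.rootTransfer nb
      else s.hook nb := by
  refine run_succ_of_not_done (h v).1 (h v).2 ?_ h1 h2
  rw [Bool.eq_false_iff, ne_eq, Option.any_eq_true]
  rintro ⟨p, hp, hd⟩
  unfold NodeState.parentState at hp
  obtain ⟨a, -, ha⟩ := Option.bind_eq_some_iff.1 hp
  obtain ⟨-, x, hx, rfl⟩ := mem_of_lookup ha
  obtain ⟨u, -, rfl⟩ := mem_view.1 hx
  simp [(h u).1] at hd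

end Network

end SyncMST

namespace SyncMST

namespace NodeState

variable {s : NodeState} {nb : Multiset Neighbour} {o : Option NodeState}

/-- The parent's memory is a free variable `o`, so that the `match` reduces once the forest tells
who the parent is. -/
theorem countWave_of_parentState : s.parentState nb = o →
    s.countWave nb = if s.ttl = none then
      match o with
      | none => s
      | some p =>
        match p.ttl with
        | some (τ + 1) => { s with ttl := some τ, rootId := p.rootId, level := p.level }
        | _ => s
    else s := by
  rintro rfl; rfl

theorem findWave_of_parentState : s.parentState nb = o →
    s.findWave nb =
      match o with
      | none => s
      | some p =>
        if p.find then { s with find := true, rootId := p.rootId, level := p.level } else s := by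
  rintro rfl; rfl

end NodeState

namespace Network

variable {V : Type*} [Fintype V] {N : Network V} {t i : ℕ}

theorem parentState_tick {F : Forest N} {σ : V → NodeState} (h : F.Rep σ) (v : V) (c : ℕ) :
    ((σ v).tick c).parentState (N.view σ v) = (F.par v).map σ :=
  parentState_eq h v _ rfl

theorem children_tick {F : Forest N} {σ : V → NodeState} (h : F.Rep σ) (v : V) (c : ℕ) :
    ((σ v).tick c).children (N.view σ v) = (F.ch v).val.map σ :=
  children_eq h v _ (h v).1

/-! ### The rounds of a phase -/

theorem run_startPhase (h : N.Live t) (h1 : t + 1 = 11 * 2 ^ i) (v : V) :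
    N.run (t + 1) v = NodeState.startPhase i ((N.run t v).tick (t + 1)) := by
  have hP : 0 < 2 ^ i := by positivity
  rw [run_succ_of_live h v (i := i) (by omega) (by omega)]
  exact if_pos h1

theorem run_countWave (h : N.Live t) (h1 : 11 * 2 ^ i < t + 1) (h2 : t + 1 < 13 * 2 ^ i) (v : V) :
    N.run (t + 1) v =
      NodeState.countWave ((N.run t v).tick (t + 1)) (N.view (N.run t) v) := by
  rw [run_succ_of_live h v (i := i) (by omega) (by omega)]
  dsimp only
  split_ifs <;> first | rfl | omega

theorem run_countEcho (h : N.Live t) (h1 : 13 * 2 ^ i ≤ t + 1) (h2 : t + 1 < 15 * 2 ^ i) (v : V) :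
    N.run (t + 1) v =
      NodeState.countEcho i ((N.run t v).tick (t + 1)) (N.view (N.run t) v) := by
  rw [run_succ_of_live h v (i := i) (by omega) (by omega)]
  dsimp only
  split_ifs <;> first | rfl | omega

theorem run_startFind (h : N.Live t) (h1 : t + 1 = 15 * 2 ^ i) (v : V) :
    N.run (t + 1) v = NodeState.startFind ((N.run t v).tick (t + 1)) := by
  have hP : 0 < 2 ^ i := by positivity
  rw [run_succ_of_live h v (i := i) (by omega) (by omega)]
  dsimp only
  split_ifs <;> first | rfl | omega

theorem run_findWave (h : N.Live t) (h1 : 15 * 2 ^ i < t + 1) (h2 : t + 1 < 17 * 2 ^ i) (v : V) :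
    N.run (t + 1) v =
      NodeState.findWave ((N.run t v).tick (t + 1)) (N.view (N.run t) v) := by
  rw [run_succ_of_live h v (i := i) (by omega) (by omega)]
  dsimp only
  split_ifs <;> first | rfl | omega

theorem run_findLocal (h : N.Live t) (h1 : t + 1 = 17 * 2 ^ i) (v : V) :
    N.run (t + 1) v =
      NodeState.findLocal ((N.run t v).tick (t + 1)) (N.view (N.run t) v) := by
  have hP : 0 < 2 ^ i := by positivity
  rw [run_succ_of_live h v (i := i) (by omega) (by omega)]
  dsimp only
  split_ifs <;> first | rfl | omega

theorem run_findEcho (h : N.Live t) (h1 : 17 * 2 ^ i < t + 1) (h2 : t + 1 < 19 * 2 ^ i) (v : V) :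
    N.run (t + 1) v =
      NodeState.findEcho ((N.run t v).tick (t + 1)) (N.view (N.run t) v) := by
  rw [run_succ_of_live h v (i := i) (by omega) (by omega)]
  dsimp only
  split_ifs <;> first | rfl | omega

theorem run_startTransfer (h : N.Live t) (h1 : t + 1 = 19 * 2 ^ i) (v : V) :
    N.run (t + 1) v = NodeState.startTransfer ((N.run t v).tick (t + 1)) := by
  have hP : 0 < 2 ^ i := by positivity
  rw [run_succ_of_live h v (i := i) (by omega) (by omega)]
  dsimp only
  split_ifs <;> first | rfl | omega

theorem run_rootTransfer (h : N.Live t) (h1 : 19 * 2 ^ i < t + 1) (h2 : t + 1 < 22 * 2 ^ i - 1)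
    (v : V) : N.run (t + 1) v =
      NodeState.rootTransfer ((N.run t v).tick (t + 1)) (N.view (N.run t) v) := by
  rw [run_succ_of_live h v (i := i) (by omega) (by omega)]
  dsimp only
  split_ifs <;> first | rfl | omega

theorem run_hook (h : N.Live t) (h1 : t + 1 = 22 * 2 ^ i - 1) (v : V) :
    N.run (t + 1) v = NodeState.hook ((N.run t v).tick (t + 1)) (N.view (N.run t) v) := by
  have hP : 0 < 2 ^ i := by positivity
  rw [run_succ_of_live h v (i := i) (by omega) (by omega)]
  dsimp only
  split_ifs <;> first | rfl | omega

/-! ### The start of a phase -/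

/-- The configuration just before phase `i`, if no node has terminated by then. -/
structure PhaseStart (N : Network V) (i : ℕ) (F : Forest N) : Prop where
  live : N.Live (11 * 2 ^ i - 1)
  rep : F.Rep (N.run (11 * 2 ^ i - 1))
  size : ∀ v, 2 ^ i ≤ F.size v
  level : ∀ v, F.par v = none → 2 ^ (N.run (11 * 2 ^ i - 1) v).level ≤ F.size v
  rootId : ∀ v, ∃ y, (N.run (11 * 2 ^ i - 1) v).rootId = N.id y ∧ F.rt y = F.rt v
  light : ∀ v u, F.par v = some u → N.Light v u

/-! ### The counting wave -/

/-- The memory of `v` after round `11 * 2 ^ i + k`, if the memory before phase `i` was `s`. -/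
def waveState (F : Forest N) (i k : ℕ) (s : NodeState) (v : V) : NodeState where
  id := N.id v
  clock := 11 * 2 ^ i + k
  parent := (F.par v).map N.id
  rootId := if F.dep v ≤ k then N.id (F.rt v) else s.rootId
  level := if F.dep v ≤ k then i else s.level
  ttl := if F.dep v ≤ k then some (2 ^ (i + 1) - 1 - F.dep v) else none
  count := none
  covers := false
  active := false
  find := false
  cand := ⊤
  found := false
  transfer := false
  done := false

variable {F : Forest N}

/-- The wave descends one level per round, and the rounds reserved for it end exactly when the
time-to-live is used up. Nodes that are not reached keep an old root estimate; this is why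
`PhaseStart.rootId` belongs to the invariant. -/
theorem PhaseStart.run_wave (h : N.PhaseStart i F) {k : ℕ} (hk : k ≤ 2 ^ (i + 1) - 1) :
    N.run (11 * 2 ^ i + k) = fun v => waveState F i k (N.run (11 * 2 ^ i - 1) v) v := by
  have hP : 0 < 2 ^ i := by positivity
  have hP' : 2 ^ (i + 1) = 2 * 2 ^ i := by rw [pow_succ]; ring
  induction k with
  | zero =>
    ext1 v
    have h1 : 11 * 2 ^ i - 1 + 1 = 11 * 2 ^ i := by omega
    have := run_startPhase (i := i) h.live h1 v
    rw [h1] at this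
    rw [add_zero, this]
    have hv := h.rep v
    have hd := (h.live v).1
    generalize N.run (11 * 2 ^ i - 1) v = s at hv hd
    cases hp : F.par v with
    | none =>
      simp [NodeState.startPhase, NodeState.tick, waveState, hp, hv, F.dep_root hp, F.rt_root hp, hd]
    | some u =>
      have := F.dep_child hp
      simp [NodeState.startPhase, NodeState.tick, waveState, hp, hv, this, hd]
  | succ k ih =>
    specialize ih (by omega)
    have hlive : N.Live (11 * 2 ^ i + k) := by
      intro v; rw [ih]; exact ⟨rfl, rfl⟩
    have hrep : F.Rep (N.run (11 * 2 ^ i + k)) := by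
      intro v; rw [ih]; exact ⟨rfl, rfl⟩
    ext1 v
    rw [← add_assoc, run_countWave (i := i) hlive (by omega) (by omega)]
    rw [NodeState.countWave_of_parentState (parentState_tick hrep v _), ih]
    cases hp : F.par v with
    | none =>
      simp [NodeState.tick, waveState, hp, F.dep_root hp, add_assoc]
    | some u =>
      have hd := F.dep_child hp
      simp only [NodeState.tick, waveState, hp, Option.map_some, hd, F.rt_child hp]
      by_cases h1 : F.dep u + 1 ≤ k
      · have h2 : F.dep u + 1 ≤ k + 1 := by omega
        simp [h1, h2, add_assoc]
      · by_cases h2 : F.dep u ≤ k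
        -- Here the parent has depth exactly `k`, which is less than `2 ^ (i + 1) - 1`; its
        -- time-to-live is positive and `v` accepts now.
        · obtain ⟨τ, hτ⟩ : ∃ τ, 2 ^ (i + 1) - 1 - F.dep u = τ + 1 :=
            ⟨2 ^ (i + 1) - 1 - F.dep u - 1, by omega⟩
          have h3 : 2 ^ (i + 1) - 1 - (F.dep u + 1) = τ := by omega
          simp [h1, h2, hτ, h3, add_assoc]
        · simp [h1, h2, add_assoc]

end Network

/-! ### Truncated subtrees: counting and coverage -/

namespace Forest

variable {V : Type*} [Fintype V] {N : Network V} (F : Forest N)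

open Classical in
/-- The descendants of `v` of depth at most `M`. -/
noncomputable def sub (M : ℕ) (v : V) : Finset V :=
  Finset.univ.filter (fun u => F.dep u ≤ M ∧ F.Desc u v)

/-- All neighbours of the descendants of `v` of depth at most `M` have depth at most `M` and the
same root as `v`. -/
def Covers (M : ℕ) (v : V) : Prop :=
  ∀ u ∈ F.sub M v, ∀ w, N.graph.Adj u w → F.dep w ≤ M ∧ F.rt w = F.rt v

variable {F} {M : ℕ} {u v : V}

theorem mem_sub : u ∈ F.sub M v ↔ F.dep u ≤ M ∧ F.Desc u v := by simp [sub]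

theorem sub_of_dep_eq (h : F.dep v = M) : F.sub M v = {v} := by
  ext u
  rw [mem_sub, Finset.mem_singleton]
  constructor
  · rintro ⟨h1, h2⟩
    rcases h2.eq_or_lt with h3 | h3
    · exact h3
    · omega
  · rintro rfl
    exact ⟨h.le, Desc.refl _⟩

theorem mem_sub_iff_child (h : F.dep v < M) :
    u ∈ F.sub M v ↔ u = v ∨ ∃ c, F.par c = some v ∧ u ∈ F.sub M c := by
  simp only [mem_sub]
  constructor
  · rintro ⟨h1, h2⟩
    rcases h2.eq_or_child with h3 | ⟨c, hc, h3⟩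
    · exact Or.inl h3
    · exact Or.inr ⟨c, hc, h1, h3⟩
  · rintro (rfl | ⟨c, hc, h1, h2⟩)
    · exact ⟨h.le, Desc.refl _⟩
    · exact ⟨h1, h2.parent hc⟩

/-- The truncated subtrees of the children are disjoint, as a node has at most one ancestor of each
depth. This is the sum that the echo forms. -/
theorem card_sub_of_dep_lt (h : F.dep v < M) :
    (F.sub M v).card = 1 + ∑ c ∈ F.ch v, (F.sub M c).card := by
  classical
  have hE : F.sub M v = insert v ((F.ch v).biUnion (F.sub M)) := by
    ext u
    rw [mem_sub_iff_child h]
    simp [mem_ch]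
  rw [hE, Finset.card_insert_of_notMem, Finset.card_biUnion, add_comm]
  · intro a ha b hb hab
    rw [Function.onFun, Finset.disjoint_left]
    intro u hu hu'
    rw [Finset.mem_coe, mem_ch] at ha hb
    rw [mem_sub] at hu hu'
    apply hab
    apply hu.2.eq_of_dep_eq hu'.2
    rw [F.dep_child ha, F.dep_child hb]
  · intro hv
    obtain ⟨c, hc, hv⟩ := Finset.mem_biUnion.1 hv
    rw [mem_ch] at hc
    have := (mem_sub.1 hv).2.dep_le
    have := F.dep_child hc
    omega

theorem covers_of_dep_eq (h : F.dep v = M) :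
    F.Covers M v ↔ ∀ w, N.graph.Adj v w → F.dep w ≤ M ∧ F.rt w = F.rt v := by
  simp [Covers, sub_of_dep_eq h]

theorem covers_of_dep_lt (h : F.dep v < M) :
    F.Covers M v ↔ (∀ w, N.graph.Adj v w → F.dep w ≤ M ∧ F.rt w = F.rt v) ∧
      ∀ c, F.par c = some v → F.Covers M c := by
  unfold Covers
  constructor
  · intro H
    refine ⟨H v ((mem_sub_iff_child h).2 (Or.inl rfl)), fun c hc u hu => ?_⟩
    rw [F.rt_child hc]
    exact H u ((mem_sub_iff_child h).2 (Or.inr ⟨c, hc, hu⟩))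
  · rintro ⟨H1, H2⟩ u hu
    rcases (mem_sub_iff_child h).1 hu with rfl | ⟨c, hc, hu⟩
    · exact H1
    · rw [← F.rt_child hc]; exact H2 c hc u hu

theorem card_sub_le_card : (F.sub M v).card ≤ Fintype.card V := Finset.card_le_univ _

theorem card_sub_le_size : (F.sub M v).card ≤ F.size v := by
  rw [← Set.ncard_coe_finset]
  refine Set.ncard_le_ncard (fun u hu => ?_) (Set.toFinite _)
  exact (mem_sub.1 (Finset.mem_coe.1 hu)).2.rt_eq

/-- If the tree of a root `r` has a node of depth `d`, then it has more than `M` nodes of depth at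
most `M`, for every `M ≤ d`. -/
theorem lt_card_sub_of_le_dep {d : ℕ} (hd : F.dep u = d) (hu : F.Desc u v) (hM : M ≤ d)
    (hv : F.par v = none) : M < (F.sub M v).card := by
  classical
  -- The ancestors of `u` below and including the root take every depth from `d` down to `0`.
  have hch : ∀ k ≤ d, ∃ w, F.dep w = k ∧ F.Desc w v := by
    clear hM
    induction d generalizing u with
    | zero => intro k hk; exact ⟨u, by omega, hu⟩
    | succ d ih =>
      intro k hk
      rcases Nat.lt_or_ge d k with hk' | hk'
      · exact ⟨u, by omega, hu⟩
      · cases hp : F.par u with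
        | none => have := F.dep_root hp; omega
        | some w =>
          have := F.dep_child hp
          refine ih (u := w) (by omega) ?_ k hk'
          rw [F.desc_root_iff hv] at hu ⊢
          rw [← F.rt_child hp]; exact hu
  -- The depths `0, …, M` all occur in the truncated tree, which therefore has at least `M + 1`
  -- nodes.
  have hs : Finset.range (M + 1) ⊆ (F.sub M v).image F.dep := by
    intro k hk
    obtain ⟨w, hw, hw'⟩ := hch k (by have := Finset.mem_range.1 hk; omega)
    have := Finset.mem_range.1 hk
    exact Finset.mem_image.2 ⟨w, mem_sub.2 ⟨by omega, hw'⟩, hw⟩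
  have := Finset.card_le_card hs
  rw [Finset.card_range] at this
  exact lt_of_lt_of_le (Nat.lt_of_succ_le this) Finset.card_image_le

/-- If at most `M` nodes of depth at most `M` are found below a root, these are all nodes of its
tree. -/
theorem dep_lt_of_card_sub_le (hv : F.par v = none) (h : (F.sub M v).card ≤ M)
    (hu : F.rt u = v) : F.dep u < M := by
  by_contra hd
  have := lt_card_sub_of_le_dep rfl ((F.desc_root_iff hv).2 hu) (not_lt.1 hd) hv
  omega

theorem card_sub_eq_size (hv : F.par v = none) (h : (F.sub M v).card ≤ M) :
    (F.sub M v).card = F.size v := by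
  rw [← Set.ncard_coe_finset]
  unfold size
  congr 1
  ext u
  simp only [Finset.mem_coe, mem_sub, Set.mem_ofPred_eq, F.rt_root hv, F.desc_root_iff hv]
  exact ⟨fun h => h.2, fun hu => ⟨(dep_lt_of_card_sub_le hv h hu).le, hu⟩⟩

/-- A count of at most `M` leaves no node at depth `M` or more, so nothing was cut off and the count
is exact. -/
theorem card_sub_le_iff (hv : F.par v = none) : (F.sub M v).card ≤ M ↔ F.size v ≤ M :=
  ⟨fun h => by rwa [← card_sub_eq_size hv h], fun h => card_sub_le_size.trans h⟩

/-- If a root covers, then its tree is everything. -/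
theorem Covers.all (h : F.Covers M v) (hv : F.par v = none) (u : V) :
    F.dep u ≤ M ∧ F.rt u = v := by
  obtain ⟨p⟩ := N.connected v u
  suffices ∀ a b : V, N.graph.Walk a b → F.dep a ≤ M ∧ F.rt a = v → F.dep b ≤ M ∧ F.rt b = v from
    this v u p ⟨by rw [F.dep_root hv]; omega, F.rt_root hv⟩
  intro a b p
  induction p with
  | nil => exact id
  | cons hab _ ih =>
    rintro ⟨h1, h2⟩
    apply ih
    have := h _ (mem_sub.2 ⟨h1, (F.desc_root_iff hv).2 h2⟩) _ hab
    rwa [F.rt_root hv] at this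

end Forest

end SyncMST

namespace SyncMST

/-! ### Progress of an echo in a forest -/

namespace Forest

variable {V : Type*} {N : Network V}

/-- After `k` rounds of an echo among the nodes that satisfy `A`, the nodes that satisfy `h` have
echoed; `M` bounds the depth. -/
structure Echo (F : Forest N) (A : V → Prop) (M k : ℕ) (h : V → Prop) : Prop where
  mem : ∀ {v}, h v → A v
  child : ∀ {v c}, h v → F.par c = some v → A c → h c
  progress : ∀ {v}, A v → M < F.dep v + k → h v

/-- The nodes that have echoed one round later. -/
def echoNext (F : Forest N) (A h : V → Prop) (v : V) : Prop :=
  A v ∧ (h v ∨ ∀ c, F.par c = some v → A c → h c)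

variable {F : Forest N} {A h : V → Prop} {M k : ℕ}

theorem Echo.zero (hA : ∀ v, A v → F.dep v ≤ M) : F.Echo A M 0 (fun _ => False) where
  mem h := h.elim
  child h := h.elim
  progress h1 h2 := by have := hA _ h1; omega

/-- Progress: children are one level deeper, so the bound for the previous round says that they have
all echoed. -/
theorem Echo.next (H : F.Echo A M k h) : F.Echo A M (k + 1) (F.echoNext A h) where
  mem h := h.1
  child := by
    rintro v c ⟨h1, h2⟩ hc hA
    refine ⟨hA, Or.inl ?_⟩
    rcases h2 with h2 | h2
    · exact H.child h2 hc hA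
    · exact h2 c hc hA
  progress := by
    intro v hA hv
    refine ⟨hA, Or.inr fun c hc hAc => H.progress hAc ?_⟩
    have := F.dep_child hc
    omega

/-- An echo travels upwards, so everything below a node that has echoed has echoed too. It is needed
at the moment a root terminates. -/
theorem Echo.desc (H : F.Echo A M k h) {u v : V} (huv : F.Desc u v) (hv : h v)
    (hA : ∀ w, F.Desc u w → F.Desc w v → A w) : h u := by
  unfold Desc at huv
  induction huv using Relation.ReflTransGen.head_induction_on with
  | refl => exact hv
  | @head a b hab hbv ih =>
    exact H.child (ih fun w hw => hA w (Relation.ReflTransGen.head hab hw)) hab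
      (hA a (Desc.refl a) (Relation.ReflTransGen.head hab hbv))

end Forest

/-! ### The counting echo -/

namespace Network

variable {V : Type*} [Fintype V] {N : Network V} {t i : ℕ} {F : Forest N}

theorem forall_state_view {σ : V → NodeState} {v : V} {p : NodeState → Prop} :
    (∀ u ∈ (N.view σ v).map Neighbour.state, p u) ↔ ∀ w, N.graph.Adj v w → p (σ w) := by
  simp [view]

/-- The nodes that are reached by the counting wave of phase `i`. -/
def Reached (F : Forest N) (i : ℕ) (v : V) : Prop := F.dep v ≤ 2 ^ (i + 1) - 1

open Classical in
/-- The memory of `v` after round `13 * 2 ^ i - 1 + k`, if the memory before phase `i` was `s`, and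
the nodes that have echoed are those that satisfy `h`. -/
noncomputable def echoState (F : Forest N) (i k : ℕ) (h : V → Prop) (s : NodeState) (v : V) :
    NodeState :=
  { waveState F i (2 ^ (i + 1) - 1) s v with
    clock := 13 * 2 ^ i - 1 + k
    count := if h v then some (F.sub (2 ^ (i + 1) - 1) v).card else none
    covers := decide (h v ∧ F.Covers (2 ^ (i + 1) - 1) v)
    active := decide (h v ∧ F.par v = none ∧ (F.sub (2 ^ (i + 1) - 1) v).card ≤ 2 ^ (i + 1) - 1)
    level :=
      if h v ∧ F.par v = none ∧ ¬ (F.sub (2 ^ (i + 1) - 1) v).card ≤ 2 ^ (i + 1) - 1 then i + 1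
      else if F.dep v ≤ 2 ^ (i + 1) - 1 then i else s.level
    done := decide (h v ∧ F.par v = none ∧ F.Covers (2 ^ (i + 1) - 1) v) }

/-- The closed form survives a round because `countEcho` evaluates the recursions that `sub` and
`Covers` satisfy along the children. -/
theorem countEcho_echoState {k : ℕ} {h : V → Prop} {s : V → NodeState}
    (H : F.Echo (Reached F i) (2 ^ (i + 1) - 1) k h) (v : V) :
    ((echoState F i k h (s v) v).tick (13 * 2 ^ i - 1 + k + 1)).countEcho i
      (N.view (fun v => echoState F i k h (s v) v) v) =
      echoState F i (k + 1) (F.echoNext (Reached F i) h) (s v) v := by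
  classical
  have hrep : F.Rep (fun v => echoState F i k h (s v) v) := fun v => ⟨rfl, rfl⟩
  have hch := children_tick hrep v (13 * 2 ^ i - 1 + k + 1)
  have hP : 2 ^ (i + 1) - 1 + 1 = 2 ^ (i + 1) := Nat.sub_add_cancel Nat.one_le_two_pow
  set M := 2 ^ (i + 1) - 1 with hM
  by_cases hv : Reached F i v
  swap
  · have h1 : ¬ h v := fun h => hv (H.mem h)
    have h2 : ¬ F.echoNext (Reached F i) h v := fun h => hv h.1
    have h3 : ¬ F.dep v ≤ M := hv
    simp [NodeState.countEcho, NodeState.tick, echoState, waveState, ← hM, h1, h2, h3, add_assoc]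
  by_cases h1 : h v
  · have h2 : F.echoNext (Reached F i) h v := ⟨hv, Or.inl h1⟩
    simp [NodeState.countEcho, NodeState.tick, echoState, ← hM, h1, h2, add_assoc]
  have h3 : F.dep v ≤ M := hv
  -- `C` consists of the children that take part in the echo: none at depth `M`, where the
  -- time-to-live is zero, and all of them at smaller depth.
  obtain ⟨C, hC, hCC⟩ : ∃ C : Finset V,
      (if ((echoState F i k h (s v) v).tick (13 * 2 ^ i - 1 + k + 1)).ttl = some 0 then 0
        else ((echoState F i k h (s v) v).tick (13 * 2 ^ i - 1 + k + 1)).children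
          (N.view (fun v => echoState F i k h (s v) v) v)) =
        C.val.map (fun v => echoState F i k h (s v) v) ∧
      (∀ c, c ∈ C ↔ F.par c = some v ∧ Reached F i c) ∧
      (F.sub M v).card = 1 + ∑ c ∈ C, (F.sub M c).card ∧
      (F.Covers M v ↔ (∀ w, N.graph.Adj v w → F.dep w ≤ M ∧ F.rt w = F.rt v) ∧
        ∀ c ∈ C, F.Covers M c) := by
    rw [hch]
    by_cases h4 : F.dep v = M
    · refine ⟨∅, ?_, ?_, ?_, ?_⟩
      · rw [if_pos]
        · rfl
        · simp [NodeState.tick, echoState, waveState, ← hM, h4]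
      · intro c
        simp only [Finset.notMem_empty, false_iff, not_and]
        intro hc
        have := F.dep_child hc
        unfold Reached
        omega
      · simp [Forest.sub_of_dep_eq h4]
      · simp [Forest.covers_of_dep_eq h4]
    · refine ⟨F.ch v, ?_, ?_, ?_, ?_⟩
      · rw [if_neg]
        have : ¬ M ≤ F.dep v := by omega
        simp [NodeState.tick, echoState, waveState, ← hM, h3, Nat.sub_eq_zero_iff_le, this]
      · intro c
        rw [Forest.mem_ch, iff_self_and]
        intro hc
        have := F.dep_child hc
        unfold Reached
        omega
      · exact Forest.card_sub_of_dep_lt (by omega)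
      · simp_rw [Forest.mem_ch]
        exact Forest.covers_of_dep_lt (by omega)
  obtain ⟨hmem, hcard, hcov⟩ := hCC
  have hcount : (∀ u ∈ C.val.map (fun v => echoState F i k h (s v) v), u.count ≠ none) ↔
      ∀ c ∈ C, h c := by
    simp [echoState]
  have hnext : F.echoNext (Reached F i) h v ↔ ∀ c ∈ C, h c := by
    simp only [Forest.echoNext, hv, h1, false_or, true_and, hmem, and_imp]
  unfold NodeState.countEcho
  dsimp only
  rw [hC]
  by_cases h2 : F.echoNext (Reached F i) h v
  swap
  · rw [if_neg (fun h => h2 (hnext.2 (hcount.1 h.2.2)))]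
    simp [NodeState.tick, echoState, h1, h2, add_assoc]
  rw [if_pos ⟨by simp [NodeState.tick, echoState, waveState, ← hM, h3],
    by simp [NodeState.tick, echoState, h1], hcount.2 (hnext.1 h2)⟩]
  have hhC := hnext.1 h2
  have htotal : 1 + ((C.val.map (fun v => echoState F i k h (s v) v)).map
      (fun u => u.count.getD 0)).sum = (F.sub M v).card := by
    rw [hcard, Multiset.map_map]
    congr 1
    refine Finset.sum_congr rfl fun c hc => ?_
    simp [echoState, hhC c hc, ← hM]
  -- A neighbour whose time-to-live is set was reached in this phase, so its root estimate is exact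
  -- and equality of estimates means equality of roots.
  have hcovers : decide ((∀ u ∈ (N.view (fun v => echoState F i k h (s v) v) v).map
        Neighbour.state, u.ttl ≠ none ∧
          u.rootId = ((echoState F i k h (s v) v).tick (13 * 2 ^ i - 1 + k + 1)).rootId) ∧
        ∀ u ∈ C.val.map (fun v => echoState F i k h (s v) v), u.covers = true) =
      decide (F.Covers M v) := by
    rw [decide_eq_decide, hcov, forall_state_view]
    refine and_congr (forall₂_congr fun w _ => ?_) ?_
    · simp only [echoState, NodeState.tick, waveState, ← hM, h3, if_true]
      by_cases h5 : F.dep w ≤ M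
      · simp [h5, N.id_injective.eq_iff]
      · simp [h5]
    · simp only [Multiset.mem_map, Finset.mem_val, forall_exists_index, and_imp,
        forall_apply_eq_imp_iff₂]
      refine forall₂_congr fun c hc => ?_
      simp [echoState, hhC c hc, ← hM]
  rw [htotal, hcovers]
  cases hp : F.par v with
  | some u =>
    rw [if_neg (by simp [NodeState.tick, echoState, waveState, hp])]
    simp [NodeState.tick, echoState, waveState, hp, h2, ← hM, add_assoc]
  | none =>
    rw [if_pos (by simp [NodeState.tick, echoState, waveState, hp])]
    by_cases h6 : (F.sub M v).card ≤ M
    · rw [if_pos h6]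
      simp [NodeState.tick, echoState, waveState, hp, h1, h2, ← hM, h6, add_assoc]
    · rw [if_neg h6]
      simp [NodeState.tick, echoState, waveState, hp, h1, h2, ← hM, h6, add_assoc]

/-- The counting echo either runs for all of its rounds without a termination, or it is interrupted
when a root terminates. -/
theorem PhaseStart.run_echo (H : N.PhaseStart i F) {k : ℕ} (hk : k ≤ 2 * 2 ^ i) :
    ∃ k' ≤ k, ∃ h, F.Echo (Reached F i) (2 ^ (i + 1) - 1) k' h ∧
      N.run (13 * 2 ^ i - 1 + k') =
        (fun v => echoState F i k' h (N.run (11 * 2 ^ i - 1) v) v) ∧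
      ((k' = k ∧ N.Live (13 * 2 ^ i - 1 + k)) ∨
        ∃ r, F.par r = none ∧ h r ∧ F.Covers (2 ^ (i + 1) - 1) r) := by
  have hP : 0 < 2 ^ i := by positivity
  have hP' : 2 ^ (i + 1) = 2 * 2 ^ i := by rw [pow_succ]; ring
  have live : ∀ k h, N.run (13 * 2 ^ i - 1 + k) =
      (fun v => echoState F i k h (N.run (11 * 2 ^ i - 1) v) v) →
      N.Live (13 * 2 ^ i - 1 + k) ∨ ∃ r, F.par r = none ∧ h r ∧ F.Covers (2 ^ (i + 1) - 1) r := by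
    intro k h hrun
    refine or_iff_not_imp_right.2 fun hn v => ?_
    rw [hrun]
    refine ⟨?_, rfl⟩
    simp only [echoState, decide_eq_false_iff_not]
    exact fun hv => hn ⟨v, hv.2.1, hv.1, hv.2.2⟩
  induction k with
  | zero =>
    have hrun : N.run (13 * 2 ^ i - 1 + 0) =
        (fun v => echoState F i 0 (fun _ => False) (N.run (11 * 2 ^ i - 1) v) v) := by
      have h1 : 13 * 2 ^ i - 1 + 0 = 11 * 2 ^ i + (2 ^ (i + 1) - 1) := by omega
      rw [h1, H.run_wave le_rfl]
      ext1 v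
      simp only [echoState, waveState, ← h1]
      simp
    exact ⟨0, le_rfl, fun _ => False, Forest.Echo.zero (fun v hv => hv), hrun,
      (live _ _ hrun).imp_left (fun h => ⟨rfl, h⟩)⟩
  | succ k ih =>
    -- After a termination the closed form is no longer claimed; the earlier round `k'` is handed on
    -- unchanged.
    obtain ⟨k', hk', h, hE, hrun, ⟨rfl, hl⟩ | hr⟩ := ih (by omega)
    swap
    · exact ⟨k', by omega, h, hE, hrun, Or.inr hr⟩
    have hrun' : N.run (13 * 2 ^ i - 1 + (k' + 1)) = (fun v => echoState F i (k' + 1)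
        (F.echoNext (Reached F i) h) (N.run (11 * 2 ^ i - 1) v) v) := by
      ext1 v
      rw [← add_assoc, run_countEcho (i := i) hl (by omega) (by omega), hrun]
      exact countEcho_echoState hE v
    exact ⟨k' + 1, le_rfl, _, hE.next, hrun', (live _ _ hrun').imp_left (fun h => ⟨rfl, h⟩)⟩

end Network

end SyncMST

namespace SyncMST

namespace Network

variable {V : Type*} [Fintype V] {N : Network V} {t i : ℕ} {F : Forest N}

/-! ### Spanning forests with a single tree -/

theorem output_adj {t : ℕ} (h : F.Rep (N.run t)) {a b : V} :
    (N.output t).Adj a b ↔ F.par a = some b ∨ F.par b = some a := by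
  unfold output
  rw [SimpleGraph.fromRel_adj, h.parent_eq_some, h.parent_eq_some]
  refine and_iff_right_of_imp ?_
  rintro (h | h)
  · exact (F.adj h).ne
  · exact (F.adj h).ne'

/-- The pointers connect every node to `r`, and each edge is the pointer of a node other than `r`.
So the graph is connected with at most `n - 1` edges, all of them light. -/
theorem isMST_output {r : V} (h : F.Rep (N.run t)) (hr : ∀ v, F.rt v = r)
    (hl : ∀ v u, F.par v = some u → N.Light v u) : N.IsMST (N.output t) := by
  classical
  have hconn : (N.output t).Connected := by
    have key : ∀ v, (N.output t).Reachable v r := by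
      intro v
      have hd := F.desc_rt v
      rw [hr] at hd
      unfold Forest.Desc at hd
      clear hr
      induction hd with
      | refl => rfl
      | tail _ h1 ih => exact ih.trans ((output_adj h).2 (Or.inl h1)).reachable
    have : Nonempty V := ⟨r⟩
    exact SimpleGraph.Connected.mk (fun a b => (key a).trans (key b).symm)
  refine IsSpanningTree.isMST_of_light ⟨?_, ?_⟩ ?_
  · intro a b hab
    rcases (output_adj h).1 hab with h | h
    · exact F.adj h
    · exact (F.adj h).symm
  · rw [SimpleGraph.isTree_iff_connected_and_card]
    refine ⟨hconn, le_antisymm ?_ hconn.card_vert_le_card_edgeSet_add_one⟩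
    have hsub : (N.output t).edgeSet ⊆
        (fun v => s(v, (F.par v).getD v)) '' {v | v ≠ r} := by
      intro e
      induction e with
      | _ a b =>
        have key : ∀ a b, F.par a = some b → a ≠ r := by
          rintro a b hab rfl
          have := F.par_rt a
          rw [hr, hab] at this
          simp at this
        intro hab
        rcases (output_adj h).1 hab with h | h
        · exact ⟨a, key _ _ h, by simp [h]⟩
        · exact ⟨b, key _ _ h, by simp [h, Sym2.eq_swap]⟩
    rw [Nat.card_coe_set_eq]
    have h1 := (Set.ncard_le_ncard hsub (Set.toFinite _)).trans (Set.ncard_image_le (Set.toFinite _))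
    have h2 : {v | v ≠ r}.ncard + 1 = Nat.card V := by
      have : {v | v ≠ r} = ({r} : Set V)ᶜ := rfl
      rw [this, ← Set.ncard_add_ncard_compl ({r} : Set V), Set.ncard_singleton, add_comm]
    omega
  · intro a b hab
    rcases (output_adj h).1 hab with h | h
    · exact hl _ _ h
    · exact (hl _ _ h).symm

/-! ### Termination -/

/-- After round `t` the pointers form a forest, the tree of a root of level `j` has at least `2 ^ j`
nodes, and no node has counted more nodes than there are. -/
def Good (N : Network V) (t : ℕ) : Prop :=
  ∃ F : Forest N, F.Rep (N.run t) ∧ (∀ r, F.par r = none → 2 ^ (N.run t r).level ≤ F.size r) ∧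
    ∀ v c, (N.run t v).count = some c → c ≤ Fintype.card V

theorem PhaseStart.good_wave (H : N.PhaseStart i F) {k : ℕ} (hk : k ≤ 2 ^ (i + 1) - 1) :
    N.Good (11 * 2 ^ i + k) := by
  refine ⟨F, ?_, ?_, ?_⟩ <;> rw [H.run_wave hk]
  · exact fun v => ⟨rfl, rfl⟩
  · intro r hr
    simp [waveState, F.dep_root hr, H.size]
  · intro v c hc
    simp [waveState] at hc

/-- A root takes level `i + 1` only after counting at least `2 ^ (i + 1)` nodes of its tree. -/
theorem good_of_echoState (H : N.PhaseStart i F) {k : ℕ} {h : V → Prop} {s : V → NodeState}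
    (hrun : N.run t = fun v => echoState F i k h (s v) v) : N.Good t := by
  classical
  refine ⟨F, ?_, ?_, ?_⟩ <;> rw [hrun]
  · exact fun v => ⟨rfl, rfl⟩
  · intro r hr
    simp only [echoState, F.dep_root hr, zero_le, if_true]
    split_ifs with h
    · have h1 := h.2.2
      have h2 : (F.sub (2 ^ (i + 1) - 1) r).card ≤ F.size r := Forest.card_sub_le_size
      omega
    · exact H.size r
  · intro v c hc
    simp only [echoState, Option.ite_none_right_eq_some, Option.some.injEq] at hc
    rw [← hc.2]
    exact Forest.card_sub_le_card

theorem Good.congr {t' : ℕ} (h : N.Good t)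
    (h' : ∀ v, (N.run t' v).id = (N.run t v).id ∧ (N.run t' v).parent = (N.run t v).parent ∧
      (N.run t' v).level = (N.run t v).level ∧ (N.run t' v).count = (N.run t v).count) :
    N.Good t' := by
  obtain ⟨F, h1, h2, h3⟩ := h
  refine ⟨F, fun v => ?_, fun v => ?_, fun v => ?_⟩
  · rw [(h' v).1, (h' v).2.1]; exact h1 v
  · rw [(h' v).2.2.1]; exact h2 v
  · rw [(h' v).2.2.2]; exact h3 v

/-- If a root terminates during the counting echo, then the termination spreads over the whole
network, and nothing else changes any more. -/
theorem run_of_covers {k : ℕ} {h : V → Prop}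
    (hk : k ≤ 2 * 2 ^ i) (hE : F.Echo (Reached F i) (2 ^ (i + 1) - 1) k h)
    (hrun : N.run (13 * 2 ^ i - 1 + k) =
      fun v => echoState F i k h (N.run (11 * 2 ^ i - 1) v) v) {r : V}
    (hr : F.par r = none) (hhr : h r) (hcov : F.Covers (2 ^ (i + 1) - 1) r) (j : ℕ) (v : V) :
    ∃ c d, N.run (13 * 2 ^ i - 1 + k + j) v =
      { N.run (13 * 2 ^ i - 1 + k) v with clock := c, done := d } ∧
      (F.dep v ≤ j → d = true) ∧ (d = false → c = 13 * 2 ^ i - 1 + k + j) := by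
  classical
  have hP : 0 < 2 ^ i := by positivity
  have hP' : 2 ^ (i + 1) = 2 * 2 ^ i := by rw [pow_succ]; ring
  have hall : ∀ u, F.dep u ≤ 2 ^ (i + 1) - 1 ∧ F.rt u = r := hcov.all hr
  -- All nodes lie below `r` within reach of the wave, so all of them have echoed, and `countEcho`
  -- is idle from now on.
  have hh : ∀ u, h u := fun u =>
    hE.desc ((F.desc_root_iff hr).2 (hall u).2) hhr (fun w _ _ => (hall w).1)
  have hroot : ∀ u, F.par u = none → u = r := by
    intro u hu; rw [← (hall u).2, F.rt_root hu]
  induction j generalizing v with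
  | zero =>
    refine ⟨_, _, rfl, fun hd => ?_, fun _ => ?_⟩
    · rw [Nat.le_zero, F.dep_eq_zero_iff] at hd
      have := hroot v hd
      subst this
      rw [add_zero, hrun]
      simp [echoState, hhr, hr, hcov]
    · rw [add_zero, hrun]; rfl
  | succ j ih =>
    obtain ⟨c, d, h1, h2, h3⟩ := ih v
    cases d with
    | true =>
      refine ⟨c, true, ?_, fun _ => rfl, by simp⟩
      rw [← add_assoc, run_succ_of_done, h1]
      rw [h1]
    | false =>
      have hrep : F.Rep (N.run (13 * 2 ^ i - 1 + k + j)) := by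
        intro u
        obtain ⟨c, d, h, -⟩ := ih u
        rw [h, hrun]
        exact ⟨rfl, rfl⟩
      have hdj : ¬ F.dep v ≤ j := fun h => by simpa using h2 h
      cases hp : F.par v with
      | none => have := F.dep_root hp; omega
      | some u =>
        have hps : (N.run (13 * 2 ^ i - 1 + k + j) v).parentState
            (N.view (N.run (13 * 2 ^ i - 1 + k + j)) v) =
            some (N.run (13 * 2 ^ i - 1 + k + j) u) := by
          rw [parentState_eq hrep v _ rfl, hp]; rfl
        have hdv : (N.run (13 * 2 ^ i - 1 + k + j) v).done = false := by rw [h1]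
        have hcv : (N.run (13 * 2 ^ i - 1 + k + j) v).clock = 13 * 2 ^ i - 1 + k + j := by
          rw [h1]; exact h3 rfl
        obtain ⟨cu, du, hu1, hu2, hu3⟩ := ih u
        have hd := F.dep_child hp
        have hv := (hall v).1
        rw [← add_assoc]
        cases hdu : du with
        | true =>
          refine ⟨13 * 2 ^ i - 1 + k + j + 1, true, ?_, fun _ => rfl, by simp⟩
          show (N.run _ v).step _ = _
          unfold NodeState.step
          rw [if_neg (by simp [hdv])]
          dsimp only
          rw [if_pos]
          · rw [hcv, h1]
          · have : (NodeState.parentState { N.run (13 * 2 ^ i - 1 + k + j) v with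
                clock := (N.run (13 * 2 ^ i - 1 + k + j) v).clock + 1 }
                (N.view (N.run (13 * 2 ^ i - 1 + k + j)) v)) =
              some (N.run (13 * 2 ^ i - 1 + k + j) u) := hps
            rw [this, Option.any_some, hu1, hdu]
        | false =>
          refine ⟨13 * 2 ^ i - 1 + k + j + 1, false, ?_, fun hj => ?_, fun _ => rfl⟩
          swap
          · exact absurd (hu2 (by omega)) (by simp [hdu])
          have hju : ¬ F.dep u ≤ j := fun h => by simpa [hdu] using hu2 h
          rw [run_succ_of_not_done (i := i) hdv hcv
            (by rw [hps, Option.any_some, hu1, hdu]) (by omega) (by omega)]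
          have hps' := parentState_tick hrep v (13 * 2 ^ i - 1 + k + j + 1)
          rw [hp, Option.map_some] at hps'
          -- The rounds that can occur before the termination reaches `v` are all idle: `v` has
          -- echoed, it is not a root, and no searching wave has been posted.
          have e1 : NodeState.countEcho i ((N.run (13 * 2 ^ i - 1 + k + j) v).tick
              (13 * 2 ^ i - 1 + k + j + 1)) (N.view (N.run (13 * 2 ^ i - 1 + k + j)) v) =
              (N.run (13 * 2 ^ i - 1 + k + j) v).tick (13 * 2 ^ i - 1 + k + j + 1) := by
            unfold NodeState.countEcho
            dsimp only
            rw [if_neg]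
            simp only [NodeState.tick, h1, hrun, echoState, hh v]
            simp
          have e2 : NodeState.startFind ((N.run (13 * 2 ^ i - 1 + k + j) v).tick
              (13 * 2 ^ i - 1 + k + j + 1)) =
              (N.run (13 * 2 ^ i - 1 + k + j) v).tick (13 * 2 ^ i - 1 + k + j + 1) := by
            simp [NodeState.startFind, NodeState.tick, h1, hrun, echoState, hp]
          have e3 : NodeState.findWave ((N.run (13 * 2 ^ i - 1 + k + j) v).tick
              (13 * 2 ^ i - 1 + k + j + 1)) (N.view (N.run (13 * 2 ^ i - 1 + k + j)) v) =
              (N.run (13 * 2 ^ i - 1 + k + j) v).tick (13 * 2 ^ i - 1 + k + j + 1) := by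
            rw [NodeState.findWave_of_parentState hps']
            simp [hu1, hrun, echoState, waveState]
          -- Since `v` is not done, `j` is less than its depth, which is at most `2 ^ (i + 1) - 1`;
          -- moreover `k ≤ 2 * 2 ^ i`. Hence no action from `findLocal` on can occur.
          have e4 : 13 * 2 ^ i - 1 + k + j + 1 < 17 * 2 ^ i := by omega
          have e5 : (N.run (13 * 2 ^ i - 1 + k + j) v).tick (13 * 2 ^ i - 1 + k + j + 1) =
              { N.run (13 * 2 ^ i - 1 + k) v with
                clock := 13 * 2 ^ i - 1 + k + j + 1, done := false } := by
            rw [h1]; rfl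
          rw [← e5]
          dsimp only
          rw [e1, e2, e3, if_neg (by omega), if_neg (by omega), if_pos e4]
          simp only [ite_self]

/-- A phase in which a root terminates is the last one. -/
theorem PhaseStart.finish_of_covers (H : N.PhaseStart i F) {k : ℕ} {h : V → Prop}
    (hk : k ≤ 2 * 2 ^ i) (hE : F.Echo (Reached F i) (2 ^ (i + 1) - 1) k h)
    (hrun : N.run (13 * 2 ^ i - 1 + k) =
      fun v => echoState F i k h (N.run (11 * 2 ^ i - 1) v) v) {r : V}
    (hr : F.par r = none) (hhr : h r) (hcov : F.Covers (2 ^ (i + 1) - 1) r) :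
    (∀ t, 13 * 2 ^ i - 1 + k ≤ t → N.Good t) ∧
      ∀ t, 22 * 2 ^ i - 1 ≤ t → (∀ v, (N.run t v).done = true) ∧ N.IsMST (N.output t) := by
  have hP : 0 < 2 ^ i := by positivity
  have hP' : 2 ^ (i + 1) = 2 * 2 ^ i := by rw [pow_succ]; ring
  have key := run_of_covers hk hE hrun hr hhr hcov
  constructor
  · intro t ht
    obtain ⟨j, rfl⟩ := Nat.exists_eq_add_of_le ht
    refine (good_of_echoState H hrun).congr fun v => ?_
    obtain ⟨c, d, h, -⟩ := key j v
    rw [h]; exact ⟨rfl, rfl, rfl, rfl⟩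
  · intro t ht
    obtain ⟨j, rfl⟩ := Nat.exists_eq_add_of_le (show 13 * 2 ^ i - 1 + k ≤ t by omega)
    constructor
    · intro v
      obtain ⟨c, d, h1, h2, -⟩ := key j v
      rw [h1]
      apply h2
      have := (hcov.all hr v).1
      omega
    · refine isMST_output (F := F) (r := r) (fun v => ?_) (fun v => (hcov.all hr v).2) H.light
      obtain ⟨c, d, h1, -⟩ := key j v
      rw [h1, hrun]
      exact ⟨rfl, rfl⟩

end Network

end SyncMST

namespace SyncMST

/-! ### Small trees -/

theorem Forest.size_eq {V : Type*} {N : Network V} {F : Forest N} {u v : V}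
    (h : F.rt u = F.rt v) : F.size u = F.size v := by
  unfold Forest.size; rw [h]

/-- The tree of `v` has less than `2 ^ (i + 1)` nodes. -/
def Network.Small {V : Type*} {N : Network V} (F : Forest N) (i : ℕ) (v : V) : Prop :=
  F.size v ≤ 2 ^ (i + 1) - 1

theorem Network.small_congr {V : Type*} {N : Network V} {F : Forest N} {i : ℕ} {u v : V}
    (h : F.rt u = F.rt v) : Network.Small F i u ↔ Network.Small F i v := by
  unfold Network.Small; rw [Forest.size_eq h]

/-! ### Minima of multisets of candidates -/

theorem Multiset.inf_eq_top_or_mem {α : Type*} [LinearOrder α] [OrderTop α] (m : Multiset α) :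
    m.inf = ⊤ ∨ m.inf ∈ m := by
  induction m using Multiset.induction_on with
  | empty => left; simp
  | cons a m ih =>
    rw [Multiset.inf_cons]
    rcases le_total a m.inf with h | h
    · right; rw [inf_eq_left.2 h]; simp
    · rw [inf_eq_right.2 h]
      exact ih.imp_right (fun h => Multiset.mem_cons_of_mem h)

namespace Candidate

theorem weight_mono {c d : Candidate} (h : c ≤ d) : c.weight ≤ d.weight := by
  rcases Prod.Lex.le_iff.1 h with h | h
  · exact h.le
  · exact h.1.le

theorem exists_of_le {c : WithTop Candidate} {d : Candidate} (h : c ≤ (d : WithTop Candidate)) :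
    ∃ e : Candidate, c = (e : WithTop Candidate) ∧ e.weight ≤ d.weight := by
  obtain ⟨e, rfl, he⟩ := WithTop.le_coe_iff.1 h
  exact ⟨e, rfl, weight_mono he⟩

end Candidate

namespace Network

variable {V : Type*} [Fintype V] {N : Network V} {t i : ℕ} {F : Forest N}

/-! ### The result of the counting echo -/

open Classical in
/-- The configuration `b` after the counting echo of phase `i`, if no root has terminated. -/
structure Counted (N : Network V) (i : ℕ) (F : Forest N) (b : V → NodeState) : Prop where
  rep : F.Rep b
  done : ∀ v, (b v).done = false
  find : ∀ v, (b v).find = false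
  found : ∀ v, (b v).found = false
  transfer : ∀ v, (b v).transfer = false
  cand : ∀ v, (b v).cand = ⊤
  active : ∀ v, (b v).active = decide (F.par v = none ∧ Small F i v)
  rootId : ∀ v, ∃ y, (b v).rootId = N.id y ∧ F.rt y = F.rt v
  small : ∀ v, Small F i v →
    F.dep v < 2 ^ (i + 1) - 1 ∧ (b v).rootId = N.id (F.rt v) ∧ (b v).level = i
  level : ∀ v, F.par v = none → 2 ^ (b v).level ≤ F.size v
  count : ∀ v c, (b v).count = some c → c ≤ Fintype.card V
  size : ∀ v, 2 ^ i ≤ F.size v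
  light : ∀ v u, F.par v = some u → N.Light v u
  leaves : ∀ v, Small F i v → ∃ a b, F.rt a = F.rt v ∧ F.rt b ≠ F.rt v ∧ N.graph.Adj a b

/-- A small tree has depth less than `2 ^ (i + 1) - 1`, so it is counted entirely. If no edge left
it, its root would cover and would have terminated; this gives `leaves`. -/
theorem PhaseStart.counted (H : N.PhaseStart i F) (hl : N.Live (15 * 2 ^ i - 1))
    (hrun : N.run (15 * 2 ^ i - 1) =
      fun v => echoState F i (2 * 2 ^ i) (Reached F i) (N.run (11 * 2 ^ i - 1) v) v) :
    N.Counted i F (N.run (15 * 2 ^ i - 1)) := by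
  classical
  have hnc : ∀ r, F.par r = none → ¬ F.Covers (2 ^ (i + 1) - 1) r := by
    intro r hr hc
    have := (hl r).1
    rw [hrun] at this
    simp [echoState, Reached, F.dep_root hr, hr, hc] at this
  have hlt : ∀ v, Small F i v → F.dep v < 2 ^ (i + 1) - 1 := by
    intro v hv
    rw [← small_congr (F.rt_rt v)] at hv
    exact Forest.dep_lt_of_card_sub_le (F.par_rt v)
      ((Forest.card_sub_le_iff (F.par_rt v)).2 hv) rfl
  have hdone : ∀ v, (N.run (15 * 2 ^ i - 1) v).done = false := fun v => (hl v).1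
  rw [hrun] at hdone ⊢
  constructor
  · exact fun v => ⟨rfl, rfl⟩
  · exact hdone
  · exact fun v => rfl
  · exact fun v => rfl
  · exact fun v => rfl
  · exact fun v => rfl
  · intro v
    simp only [echoState, decide_eq_decide]
    constructor
    · rintro ⟨-, h1, h2⟩
      exact ⟨h1, (Forest.card_sub_le_iff h1).1 h2⟩
    · rintro ⟨h1, h2⟩
      exact ⟨(hlt v h2).le, h1, (Forest.card_sub_le_iff h1).2 h2⟩
  · intro v
    simp only [echoState, waveState]
    split_ifs
    · exact ⟨_, rfl, F.rt_rt v⟩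
    · exact H.rootId v
  · intro v hv
    have h := hlt v hv
    refine ⟨h, ?_, ?_⟩
    · simp [echoState, waveState, h.le]
    · simp only [echoState, h.le, if_true]
      rw [if_neg]
      rintro ⟨-, h1, h2⟩
      exact h2 ((Forest.card_sub_le_iff h1).2 hv)
  · intro r hr
    simp only [echoState, F.dep_root hr, zero_le, if_true]
    split_ifs with h
    · have h1 := h.2.2
      have h2 : (F.sub (2 ^ (i + 1) - 1) r).card ≤ F.size r := Forest.card_sub_le_size
      omega
    · exact H.size r
  · intro v c hc
    simp only [echoState, Option.ite_none_right_eq_some, Option.some.injEq] at hc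
    rw [← hc.2]
    exact Forest.card_sub_le_card
  · exact H.size
  · exact H.light
  · intro v hv
    by_contra hn
    push Not at hn
    apply hnc _ (F.par_rt v)
    intro a ha w haw
    have h1 := (Forest.mem_sub.1 ha).2
    rw [F.desc_root_iff (F.par_rt v)] at h1
    have h2 : F.rt w = F.rt v := by
      by_contra h
      exact hn a w h1 h haw
    rw [F.rt_rt]
    exact ⟨(hlt w ((small_congr h2).2 hv)).le, h2⟩

/-! ### The searching wave -/

variable {b : V → NodeState}

theorem good_of_counted (C : N.Counted i F b)
    (h : ∀ v, (N.run t v).id = (b v).id ∧ (N.run t v).parent = (b v).parent ∧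
      (N.run t v).level = (b v).level ∧ (N.run t v).count = (b v).count) : N.Good t := by
  refine ⟨F, fun v => ?_, fun v hv => ?_, fun v c hc => ?_⟩
  · rw [(h v).1, (h v).2.1]; exact C.rep v
  · rw [(h v).2.2.1]; exact C.level v hv
  · rw [(h v).2.2.2] at hc; exact C.count v c hc

-- Only the roots of small trees are active. The identity and the level carried by the wave agree
-- with what the counting wave left, so only `find` and the clock change.
open Classical in
theorem Counted.run_findWave (C : N.Counted i F b) (hl : N.Live (15 * 2 ^ i - 1))
    (hb : N.run (15 * 2 ^ i - 1) = b) {k : ℕ} (hk : k ≤ 2 ^ (i + 1) - 1) :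
    N.run (15 * 2 ^ i + k) = fun v =>
      { b v with clock := 15 * 2 ^ i + k, find := decide (Small F i v ∧ F.dep v ≤ k) } := by
  have hP : 0 < 2 ^ i := by positivity
  have hP' : 2 ^ (i + 1) = 2 * 2 ^ i := by rw [pow_succ]; ring
  induction k with
  | zero =>
    ext1 v
    have h1 : 15 * 2 ^ i - 1 + 1 = 15 * 2 ^ i := by omega
    have := run_startFind (i := i) hl h1 v
    rw [h1, hb] at this
    rw [add_zero, this]
    have h2 := C.active v
    simp only [← F.dep_eq_zero_iff] at h2
    by_cases h : F.dep v = 0 ∧ Small F i v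
    · simp [NodeState.startFind, NodeState.tick, h2, h]
    · have h' : ¬ (Small F i v ∧ F.dep v = 0) := fun h' => h ⟨h'.2, h'.1⟩
      simp [NodeState.startFind, NodeState.tick, h2, h, h', C.find v]
  | succ k ih =>
    specialize ih (by omega)
    have hlive : N.Live (15 * 2 ^ i + k) := by
      intro v; rw [ih]; exact ⟨C.done v, rfl⟩
    have hrep : F.Rep (N.run (15 * 2 ^ i + k)) := by
      intro v; rw [ih]; exact C.rep v
    ext1 v
    rw [← add_assoc, N.run_findWave (i := i) hlive (by omega) (by omega),
      NodeState.findWave_of_parentState (parentState_tick hrep v _), ih]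
    cases hp : F.par v with
    | none => simp [NodeState.tick, F.dep_root hp]
    | some u =>
      have hd := F.dep_child hp
      have hs := small_congr (i := i) (F.rt_child hp)
      by_cases h1 : Small F i v
      · by_cases h2 : F.dep u ≤ k
        · have h3 := C.small v h1
          have h4 := C.small u (hs.1 h1)
          have h5 : N.id (F.rt u) = (b v).rootId := by rw [h3.2.1, F.rt_child hp]
          simp [NodeState.tick, hd, h2, h1, ← hs, h4.2.1, h4.2.2, h5, h3.2.2]
        · have h3 : ¬ F.dep u + 1 ≤ k := by omega
          simp [NodeState.tick, hd, h2, h3]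
      · simp [NodeState.tick, h1, ← hs]

/-! ### The searching echo -/

/-- The candidate `c` is the minimum edge that leads from `v` to another tree. -/
structure BestLocal (F : Forest N) (v : V) (c : WithTop Candidate) : Prop where
  le : ∀ b, N.graph.Adj v b → F.rt b ≠ F.rt v →
    ∃ e : Candidate, c = e ∧ e.weight ≤ N.weight s(v, b)
  mem : ∀ e : Candidate, c = e → ∃ b, N.graph.Adj v b ∧ F.rt b ≠ F.rt v ∧
    e = Candidate.mk (N.weight s(v, b)) (N.id v) (N.id b) (N.id b)

/-- The candidate `c` is the minimum edge that leads from a descendant of `v` to another tree. -/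
structure Best (F : Forest N) (v : V) (c : WithTop Candidate) : Prop where
  le : ∀ a b, F.Desc a v → N.graph.Adj a b → F.rt b ≠ F.rt v →
    ∃ e : Candidate, c = e ∧ e.weight ≤ N.weight s(a, b)
  mem : ∀ e : Candidate, c = e → ∃ a b, F.Desc a v ∧ N.graph.Adj a b ∧ F.rt b ≠ F.rt v ∧
    e.weight = N.weight s(a, b) ∧ e.inner = N.id a ∧ e.outer = N.id b ∧
    (a = v ∧ e.next = N.id b ∨ ∃ u, F.par u = some v ∧ F.Desc a u ∧ e.next = N.id u)

/-- Every descendant is the node itself or lies below a child, and `via` changes only the route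
pointer, so weights and endpoints survive the minimum. -/
theorem BestLocal.best {v : V} {c : WithTop Candidate} (h : BestLocal F v c)
    {d : V → WithTop Candidate} (hd : ∀ u, F.par u = some v → Best F u (d u)) :
    Best F v (c ⊓ ((F.ch v).val.map (fun u => WithTop.map (Candidate.via (N.id u)) (d u))).inf) := by
  set m := (F.ch v).val.map (fun u => WithTop.map (Candidate.via (N.id u)) (d u)) with hm
  constructor
  · intro a b ha hab hb
    have key : ∀ x : WithTop Candidate, c ⊓ m.inf ≤ x → ∀ e : Candidate, x = e →
        e.weight ≤ N.weight s(a, b) →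
        ∃ e : Candidate, c ⊓ m.inf = e ∧ e.weight ≤ N.weight s(a, b) := by
      rintro x hx e rfl he
      obtain ⟨e', h1, h2⟩ := Candidate.exists_of_le hx
      exact ⟨e', h1, h2.trans he⟩
    rcases ha.eq_or_child with rfl | ⟨u, hu, hau⟩
    · obtain ⟨e, he, hle⟩ := h.le b hab hb
      exact key c inf_le_left e he hle
    · obtain ⟨e, he, hle⟩ := (hd u hu).le a b hau hab (by rwa [F.rt_child hu])
      refine key (WithTop.map (Candidate.via (N.id u)) (d u)) (inf_le_right.trans
        (Multiset.inf_le ?_)) (e.via (N.id u)) (by rw [he]; rfl) hle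
      exact Multiset.mem_map.2 ⟨u, Forest.mem_ch.2 hu, rfl⟩
  · intro e he
    have hcases : c = e ∨ m.inf = e := by
      rcases le_total c m.inf with h1 | h1
      · left; rwa [inf_eq_left.2 h1] at he
      · right; rwa [inf_eq_right.2 h1] at he
    rcases hcases with h1 | h1
    · obtain ⟨b, hb1, hb2, rfl⟩ := h.mem e h1
      exact ⟨v, b, Forest.Desc.refl v, hb1, hb2, rfl, rfl, rfl, Or.inl ⟨rfl, rfl⟩⟩
    · rcases Multiset.inf_eq_top_or_mem m with h2 | h2
      · rw [h1] at h2; exact absurd h2 (WithTop.coe_ne_top)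
      · rw [h1] at h2
        obtain ⟨u, hu, h3⟩ := Multiset.mem_map.1 h2
        have hu' : F.par u = some v := Forest.mem_ch.1 hu
        obtain ⟨e', he', rfl⟩ : ∃ e' : Candidate, d u = e' ∧ Candidate.via (N.id u) e' = e := by
          rcases hdu : d u with _ | e'
          · rw [hdu] at h3; cases h3
          · rw [hdu] at h3; exact ⟨e', rfl, Option.some_injective _ h3⟩
        obtain ⟨a, b, k1, k2, k3, k4, k5, k6, -⟩ := (hd u hu').mem e' he'
        exact ⟨a, b, k1.parent hu', k2, by rwa [F.rt_child hu'] at k3, k4, k5, k6,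
          Or.inr ⟨u, hu', k1, rfl⟩⟩

/-- The memory of `v` after round `17 * 2 ^ i + k`, if the memory after the counting echo was `s`,
the candidate is `c`, and the nodes that have echoed are those that satisfy `h`. -/
noncomputable def findState (F : Forest N) (i k : ℕ) (h : V → Prop) (c : WithTop Candidate)
    (s : NodeState) (v : V) : NodeState :=
  open Classical in
  { s with
    clock := 17 * 2 ^ i + k
    find := decide (Small F i v)
    cand := c
    found := decide (h v) }

/-- Comparing root estimates amounts to comparing trees. In a small tree the estimates are exact;
elsewhere an estimate may be outdated, but it still names a node of the neighbour's own tree, hence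
not the root of `v`. -/
theorem Counted.bestLocal (C : N.Counted i F b) {v : V} (hv : Small F i v) {σ : V → NodeState}
    (hσ : ∀ v, (σ v).rootId = (b v).rootId ∧ (σ v).id = (b v).id) {r : ℕ}
    (hr : r = (b v).rootId) {d : ℕ} (hd : d = N.id v) :
    BestLocal F v (((N.view σ v).filter (fun x => x.state.rootId ≠ r)).map (fun x =>
        ((Candidate.mk x.weight d x.state.id x.state.id : Candidate) :
          WithTop Candidate))).inf := by
  subst hr hd
  have key : ∀ x, (σ x).rootId ≠ (b v).rootId ↔ F.rt x ≠ F.rt v := by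
    intro x
    rw [(hσ x).1, (C.small v hv).2.1, not_iff_not]
    constructor
    · intro h
      obtain ⟨y, h1, h2⟩ := C.rootId x
      rw [h1] at h
      rw [← h2, N.id_injective h, F.rt_rt]
    · intro h
      rw [(C.small x ((small_congr h).2 hv)).2.1, h]
  constructor
  · intro x hx hrx
    refine Candidate.exists_of_le (d := Candidate.mk (N.weight s(v, x)) (N.id v) (N.id x) (N.id x))
      (Multiset.inf_le (Multiset.mem_map.2 ⟨⟨N.weight s(v, x), σ x⟩, ?_, ?_⟩))
    · rw [Multiset.mem_filter]
      exact ⟨mem_view.2 ⟨x, hx, rfl⟩, (key x).2 hrx⟩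
    · rw [(hσ x).2, (C.rep x).1]
  · intro e he
    rcases Multiset.inf_eq_top_or_mem (((N.view σ v).filter
      (fun x => x.state.rootId ≠ (b v).rootId)).map (fun x =>
        ((Candidate.mk x.weight (N.id v) x.state.id x.state.id : Candidate) :
          WithTop Candidate))) with h2 | h2
    · rw [he] at h2; exact absurd h2 WithTop.coe_ne_top
    · rw [he] at h2
      obtain ⟨y, hy, h3⟩ := Multiset.mem_map.1 h2
      rw [Multiset.mem_filter] at hy
      obtain ⟨hy1, hy2⟩ := hy
      obtain ⟨x, hx, rfl⟩ := mem_view.1 hy1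
      refine ⟨x, hx, (key x).1 hy2, ?_⟩
      rw [← WithTop.coe_injective h3, (hσ x).2, (C.rep x).1]

/-- A candidate is the local minimum until the node echoes, and the minimum of its subtree from then
on. Depths in small trees are at most `2 ^ (i + 1) - 2`, so the `2 ^ (i + 1) - 1` rounds of this
echo just suffice. -/
theorem Counted.run_findEcho (C : N.Counted i F b) (hl : N.Live (15 * 2 ^ i - 1))
    (hb : N.run (15 * 2 ^ i - 1) = b) {k : ℕ} (hk : k ≤ 2 ^ (i + 1) - 1) :
    ∃ (h : V → Prop) (c : V → WithTop Candidate), F.Echo (Small F i) (2 ^ (i + 1) - 2) k h ∧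
      N.run (17 * 2 ^ i + k) = (fun v => findState F i k h (c v) (b v) v) ∧
      (∀ v, ¬ Small F i v → c v = ⊤) ∧ (∀ v, Small F i v → ¬ h v → BestLocal F v (c v)) ∧
      (∀ v, h v → Best F v (c v)) := by
  classical
  have hP : 0 < 2 ^ i := by positivity
  have hP' : 2 ^ (i + 1) = 2 * 2 ^ i := by rw [pow_succ]; ring
  induction k with
  | zero =>
    have hrun := C.run_findWave hl hb le_rfl
    have h1 : 15 * 2 ^ i + (2 ^ (i + 1) - 1) = 17 * 2 ^ i - 1 := by omega
    have h2 : 17 * 2 ^ i - 1 + 1 = 17 * 2 ^ i := by omega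
    rw [h1] at hrun
    have hlive : N.Live (17 * 2 ^ i - 1) := by
      intro v; rw [hrun]; exact ⟨C.done v, rfl⟩
    have hfind : ∀ v, (Small F i v ∧ F.dep v ≤ 2 ^ (i + 1) - 1) ↔ Small F i v :=
      fun v => and_iff_left_of_imp (fun h => (C.small v h).1.le)
    simp only [hfind] at hrun
    refine ⟨fun _ => False, fun v => (N.run (17 * 2 ^ i) v).cand, Forest.Echo.zero ?_, ?_, ?_, ?_,
      fun v hv => hv.elim⟩
    · intro v hv
      have := (C.small v hv).1
      omega
    · ext1 v
      have := run_findLocal (i := i) hlive h2 v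
      rw [h2] at this
      beta_reduce
      rw [add_zero, this, hrun]
      by_cases hv : Small F i v
      · simp [NodeState.findLocal, NodeState.tick, findState, hv, C.found v]
      · simp [NodeState.findLocal, NodeState.tick, findState, hv, C.found v]
    · intro v hv
      have := run_findLocal (i := i) hlive h2 v
      rw [h2] at this
      beta_reduce
      rw [this, hrun]
      simp [NodeState.findLocal, NodeState.tick, hv, C.cand v]
    · intro v hv _
      have := run_findLocal (i := i) hlive h2 v
      rw [h2] at this
      beta_reduce
      rw [this, hrun]
      unfold NodeState.findLocal
      rw [if_pos (by simp [NodeState.tick, hv])]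
      exact C.bestLocal hv (σ := fun v =>
        { b v with clock := 17 * 2 ^ i - 1, find := decide (Small F i v) })
        (fun v => ⟨rfl, rfl⟩) rfl (C.rep v).1
  | succ k ih =>
    obtain ⟨h, c, hE, hrun, h1, h2, h3⟩ := ih (by omega)
    have hlive : N.Live (17 * 2 ^ i + k) := by
      intro v; rw [hrun]; exact ⟨C.done v, rfl⟩
    have hrep : F.Rep (N.run (17 * 2 ^ i + k)) := by
      intro v; rw [hrun]; exact C.rep v
    refine ⟨F.echoNext (Small F i) h, fun v => if ¬ h v ∧ F.echoNext (Small F i) h v then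
      c v ⊓ ((F.ch v).val.map (fun u => WithTop.map (Candidate.via (N.id u)) (c u))).inf else c v,
      hE.next, ?_, ?_, ?_, ?_⟩
    · ext1 v
      rw [← add_assoc, N.run_findEcho (i := i) hlive (by omega) (by omega)]
      have hch := children_tick hrep v (17 * 2 ^ i + k + 1)
      unfold NodeState.findEcho
      rw [hch, hrun]
      beta_reduce
      have hall : (∀ u ∈ (F.ch v).val.map (fun v => findState F i k h (c v) (b v) v),
          u.found = true) ↔ ∀ u, F.par u = some v → h u := by
        simp [findState, Forest.mem_ch]
      have hnext : F.echoNext (Small F i) h v ↔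
          Small F i v ∧ (h v ∨ ∀ u, F.par u = some v → h u) := by
        unfold Forest.echoNext
        refine and_congr_right fun hv => or_congr_right (forall₂_congr fun u hu => ?_)
        rw [small_congr (F.rt_child hu)]
        simp [hv]
      by_cases hn : ¬ h v ∧ F.echoNext (Small F i) h v
      · have hu := (hnext.1 hn.2).2.resolve_left hn.1
        rw [if_pos ⟨by simp [NodeState.tick, findState, (hnext.1 hn.2).1],
          by simp [NodeState.tick, findState, hn.1], hall.2 hu⟩, if_pos hn, Multiset.map_map]
        have e1 : (fun u => u.cand.map (Candidate.via u.id)) ∘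
            (fun v => findState F i k h (c v) (b v) v) =
            fun u => (c u).map (Candidate.via (N.id u)) := by
          ext1 u
          simp only [Function.comp, findState, (C.rep u).1]
        have e2 := congrArg (fun f => ((F.ch v).val.map f).inf) e1
        simp only [NodeState.tick, findState, add_assoc, hn.2, decide_true] at e2 ⊢
        rw [← e2]
      · rw [if_neg hn, if_neg]
        · have : (h v ↔ F.echoNext (Small F i) h v) := by
            constructor
            · exact fun hv => ⟨hE.mem hv, Or.inl hv⟩
            · exact fun hv => by_contra fun h' => hn ⟨h', hv⟩
          simp [NodeState.tick, findState, add_assoc, this]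
        · rintro ⟨k1, k2, k3⟩
          simp only [NodeState.tick, findState, decide_eq_true_eq, decide_eq_false_iff_not] at k1 k2
          exact hn ⟨k2, hnext.2 ⟨k1, Or.inr (hall.1 k3)⟩⟩
    · intro v hv
      dsimp only
      rw [if_neg (fun h => hv h.2.1), h1 v hv]
    · intro v hv hn
      dsimp only
      rw [if_neg (fun h => hn h.2)]
      exact h2 v hv (fun h => hn ⟨hv, Or.inl h⟩)
    · intro v hv
      dsimp only
      by_cases hhv : h v
      · rw [if_neg (fun h => h.1 hhv)]; exact h3 v hhv
      · rw [if_pos ⟨hhv, hv⟩]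
        refine (h2 v hv.1 hhv).best fun u hu => h3 u ?_
        exact hv.2.resolve_left hhv u hu ((small_congr (F.rt_child hu)).2 hv.1)

/-- The result of the searching echo. -/
theorem Counted.run_found (C : N.Counted i F b) (hl : N.Live (15 * 2 ^ i - 1))
    (hb : N.run (15 * 2 ^ i - 1) = b) :
    ∃ c : V → WithTop Candidate, N.run (19 * 2 ^ i - 1) =
        (fun v => findState F i (2 ^ (i + 1) - 1) (Small F i) (c v) (b v) v) ∧
      (∀ v, ¬ Small F i v → c v = ⊤) ∧ (∀ v, Small F i v → Best F v (c v)) := by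
  have hP : 0 < 2 ^ i := by positivity
  have hP' : 2 ^ (i + 1) = 2 * 2 ^ i := by rw [pow_succ]; ring
  obtain ⟨h, c, hE, hrun, h1, -, h3⟩ := C.run_findEcho hl hb le_rfl
  have hh : h = Small F i := by
    ext v
    exact ⟨hE.mem, fun hv => hE.progress hv (by omega)⟩
  subst hh
  refine ⟨c, ?_, h1, h3⟩
  rw [← hrun]
  congr 1
  omega

end Network

end SyncMST

namespace SyncMST

namespace Network

variable {V : Type*} {N : Network V} {t i : ℕ} {F : Forest N} {b : V → NodeState}

/-! ### The candidate edges -/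

/-- The edge `{x, y}` is the minimum edge that leads from the tree of `v`, which contains `x`, to
another tree. -/
structure MinEdge (F : Forest N) (v x y : V) : Prop where
  rt_left : F.rt x = F.rt v
  rt_right : F.rt y ≠ F.rt v
  adj : N.graph.Adj x y
  le : ∀ a b, F.rt a = F.rt v → F.rt b ≠ F.rt v → N.graph.Adj a b →
    N.weight s(x, y) ≤ N.weight s(a, b)

theorem MinEdge.light {v x y : V} (h : MinEdge F v x y) : N.Light x y :=
  ⟨{a | F.rt a = F.rt v}, h.rt_left, h.rt_right, fun a ha b hb hab => h.le a b ha hb hab⟩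

/-- Distinct weights make the minimum edge unique; the opposite orientation is excluded because `y`
is outside the tree. -/
theorem MinEdge.eq {v x y a b : V} (h : MinEdge F v x y) (ha : F.rt a = F.rt v)
    (hb : F.rt b ≠ F.rt v) (hab : N.graph.Adj a b)
    (hle : N.weight s(a, b) ≤ N.weight s(x, y)) : a = x ∧ b = y := by
  have heq := N.weight_injOn (SimpleGraph.mem_edgeSet _ |>.2 hab)
    (SimpleGraph.mem_edgeSet _ |>.2 h.adj) (le_antisymm hle (h.le a b ha hb hab))
  rcases Sym2.eq_iff.1 heq with h1 | ⟨rfl, rfl⟩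
  · exact h1
  · exact absurd ha h.rt_right

/-- The best candidate of a node above the endpoint of the minimum edge is that edge. -/
theorem MinEdge.cand_eq {v x y u : V} (h : MinEdge F v x y) (hx : F.Desc x u)
    {d : WithTop Candidate} (hd : Best F u d) :
    ∃ e : Candidate, d = e ∧ e.inner = N.id x ∧ e.outer = N.id y ∧
      (x = u ∨ ∃ w, F.par w = some u ∧ F.Desc x w ∧ e.next = N.id w) := by
  have hu : F.rt u = F.rt v := by rw [← hx.rt_eq, h.rt_left]
  obtain ⟨e, he, hle⟩ := hd.le x y hx h.adj (by rw [hu]; exact h.rt_right)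
  obtain ⟨a, b, h1, h2, h3, h4, h5, h6, h7⟩ := hd.mem e he
  obtain ⟨rfl, rfl⟩ := h.eq (by rw [h1.rt_eq, hu]) (by rwa [← hu]) h2 (by rw [← h4]; exact hle)
  exact ⟨e, he, h5, h6, h7.imp_left And.left⟩

variable {inner outer : V → V}

/-- The forest `G` arises from `F` by `k` rounds of root transfers. -/
structure Transferred (F G : Forest N) (i k : ℕ) (inner : V → V) : Prop where
  rt_eq : ∀ {v u}, G.par v = some u → F.rt v = F.rt u
  root_unique : ∀ {r r'}, G.par r = none → G.par r' = none → F.rt r = F.rt r' → r = r'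
  par_eq : ∀ {v}, ¬ Small F i v → G.par v = F.par v
  desc : ∀ {r}, G.par r = none → Small F i r → F.Desc (inner r) r
  progress : ∀ {r}, G.par r = none → Small F i r → r = inner r ∨ k ≤ F.dep r
  below : ∀ {r v}, G.par r = none → Small F i r → F.Desc v r → v ≠ r → G.par v = F.par v
  light : ∀ {v u}, G.par v = some u → N.Light v u

theorem Transferred.rt_rt {G : Forest N} {k : ℕ} (h : Transferred F G i k inner) (v : V) :
    F.rt (G.rt v) = F.rt v :=
  G.apply_rt F.rt (fun _ _ => h.rt_eq) v

theorem Transferred.rt_congr {G : Forest N} {k : ℕ} (h : Transferred F G i k inner) {u v : V}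
    (huv : F.rt u = F.rt v) : G.rt u = G.rt v :=
  h.root_unique (G.par_rt u) (G.par_rt v) (by rw [h.rt_rt, h.rt_rt, huv])

variable [Fintype V]

/-- The configuration `b` after the counting echo of phase `i`, the candidates `c` that are found
in the searching echo, and the endpoints of the candidate edge of the tree of every node. -/
structure Searched (N : Network V) (i : ℕ) (F : Forest N) (b : V → NodeState)
    (c : V → WithTop Candidate) (inner outer : V → V) : Prop extends N.Counted i F b where
  best : ∀ v, Small F i v → Best F v (c v)
  cand_of_not_small : ∀ v, ¬ Small F i v → c v = ⊤
  minEdge : ∀ v, Small F i v → MinEdge F v (inner v) (outer v)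
  inner_congr : ∀ u v, F.rt u = F.rt v → inner u = inner v
  outer_congr : ∀ u v, F.rt u = F.rt v → outer u = outer v

/-- At the root, the echo has compared all edges leaving the tree. The endpoints are read off at
`F.rt v`, so that they depend on the tree only. -/
theorem Counted.searched (C : N.Counted i F b) {c : V → WithTop Candidate}
    (h1 : ∀ v, ¬ Small F i v → c v = ⊤) (h2 : ∀ v, Small F i v → Best F v (c v)) :
    ∃ inner outer, N.Searched i F b c inner outer := by
  have : ∀ v, ∃ x y, Small F i v → MinEdge F v x y := by
    intro v
    by_cases hv : Small F i v
    · have hr : Small F i (F.rt v) := (small_congr (F.rt_rt v)).2 hv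
      obtain ⟨x, y, hx, hy, hxy⟩ := C.leaves v hv
      have hdesc : ∀ a, F.rt a = F.rt v → F.Desc a (F.rt v) :=
        fun a ha => (F.desc_root_iff (F.par_rt v)).2 ha
      obtain ⟨e, he, -⟩ := (h2 _ hr).le x y (hdesc x hx) hxy (by rwa [F.rt_rt])
      obtain ⟨p, q, k1, k2, k3, k4, -⟩ := (h2 _ hr).mem e he
      refine ⟨p, q, fun _ => ⟨by rw [k1.rt_eq, F.rt_rt], by rwa [F.rt_rt] at k3, k2, ?_⟩⟩
      intro a' b' ha' hb' hab'
      obtain ⟨e', he', hle⟩ := (h2 _ hr).le a' b' (hdesc a' ha') hab' (by rwa [F.rt_rt])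
      rw [he] at he'
      rw [← k4, WithTop.coe_injective he']
      exact hle
    · exact ⟨v, v, fun h => absurd h hv⟩
  choose p q hpq using this
  refine ⟨fun v => p (F.rt v), fun v => q (F.rt v), C, h2, h1, fun v hv => ?_,
    fun u v h => by simp only [h], fun u v h => by simp only [h]⟩
  have := hpq _ ((small_congr (F.rt_rt v)).2 hv)
  exact ⟨by rw [this.rt_left, F.rt_rt], by have := this.rt_right; rwa [F.rt_rt] at this, this.adj,
    fun a b ha hb => this.le a b (by rwa [F.rt_rt]) (by rwa [F.rt_rt])⟩

/-! ### The root transfer -/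

variable {c : V → WithTop Candidate}

open Classical in
/-- The memory of `v` after round `19 * 2 ^ i + k`, if the memory after the counting echo was `s`,
the candidate is `c`, the pointers are those of the forest `G`, and the endpoint of the candidate
edge is `x`. -/
noncomputable def transferState (F G : Forest N) (i k : ℕ) (c : WithTop Candidate) (x : V)
    (s : NodeState) (v : V) : NodeState :=
  { s with
    clock := 19 * 2 ^ i + k
    find := decide (Small F i v)
    cand := c
    found := decide (Small F i v)
    parent := (G.par v).map N.id
    active := decide (G.par v = none ∧ Small F i v)
    transfer := decide (G.par v = none ∧ Small F i v ∧ v ≠ x) }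

theorem size_mono {G : Forest N} (h : ∀ u v, F.rt u = F.rt v → G.rt u = G.rt v) (v : V) :
    F.size v ≤ G.size v :=
  Set.ncard_le_ncard (fun u hu => h u v hu) (Set.toFinite _)

theorem Searched.transferred_zero (S : N.Searched i F b c inner outer) :
    Transferred F F i 0 inner where
  rt_eq h := F.rt_child h
  root_unique h h' hrr := by rwa [F.rt_root h, F.rt_root h'] at hrr
  par_eq _ := rfl
  desc hr hs := (F.desc_root_iff hr).2 (by rw [(S.minEdge _ hs).rt_left, F.rt_root hr])
  progress _ _ := Or.inr (Nat.zero_le _)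
  below _ _ _ _ := rfl
  light h := S.light _ _ h

/-- Above the inner endpoint, the best candidate of a node is the candidate of the whole tree. -/
theorem Searched.mustTransfer_eq (S : N.Searched i F b c inner outer) {v : V}
    (hv : Small F i v) (hd : F.Desc (inner v) v) {s : NodeState} (hs : s.id = N.id v)
    (hc : s.cand = c v) : s.mustTransfer = true ↔ v ≠ inner v := by
  obtain ⟨e, he, h1, -⟩ := (S.minEdge v hv).cand_eq hd (S.best v hv)
  unfold NodeState.mustTransfer
  rw [hc, he, hs]
  show (e.inner != N.id v) = true ↔ _
  rw [bne_iff_ne, h1, N.id_injective.ne_iff]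
  exact ne_comm

/-- The effect of one round of root transfers on the forest. -/
theorem Searched.exists_transferred_succ (S : N.Searched i F b c inner outer) {G : Forest N}
    {k : ℕ} (h : Transferred F G i k inner) :
    ∃ G' : Forest N, Transferred F G' i (k + 1) inner ∧
      ∃ nx : V → V,
        (∀ r, G.par r = none → Small F i r → r ≠ inner r → ∃ e : Candidate, c r = e ∧
          e.next = N.id (nx r) ∧ G.par (nx r) = some r ∧ G'.par r = some (nx r) ∧
          G'.par (nx r) = none) ∧
        ∀ v, ¬ (G.par v = none ∧ Small F i v ∧ v ≠ inner v) →
          (∀ r, G.par r = none → Small F i r → r ≠ inner r → v ≠ nx r) → G'.par v = G.par v := by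
  classical
  have key : ∀ r, ∃ w, G.par r = none ∧ Small F i r ∧ r ≠ inner r → ∃ e : Candidate, c r = e ∧
      e.next = N.id w ∧ F.par w = some r ∧ F.Desc (inner r) w ∧ G.par w = some r := by
    intro r
    by_cases hr : G.par r = none ∧ Small F i r ∧ r ≠ inner r
    · obtain ⟨h1, h2, h3⟩ := hr
      obtain ⟨e, he, -, -, hx | ⟨w, hw1, hw2, hw3⟩⟩ :=
        (S.minEdge r h2).cand_eq (h.desc h1 h2) (S.best r h2)
      · exact absurd hx.symm h3
      · refine ⟨w, fun _ => ⟨e, he, hw3, hw1, hw2, ?_⟩⟩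
        rw [h.below h1 h2 ((Forest.Desc.refl w).parent hw1) (F.adj hw1).ne, hw1]
    · exact ⟨r, fun h => absurd h hr⟩
  choose nx hnx using key
  set T : V → Prop := fun r => G.par r = none ∧ Small F i r ∧ r ≠ inner r with hT
  have hF : ∀ {r}, T r → F.par (nx r) = some r := fun hr => by
    obtain ⟨e, -, -, h, -⟩ := hnx _ hr; exact h
  have hD : ∀ {r}, T r → F.Desc (inner r) (nx r) := fun hr => by
    obtain ⟨e, -, -, -, h, -⟩ := hnx _ hr; exact h
  have hG : ∀ {r}, T r → G.par (nx r) = some r := fun hr => by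
    obtain ⟨e, -, -, -, -, h⟩ := hnx _ hr; exact h
  have hrt : ∀ {r}, T r → F.rt (nx r) = F.rt r := fun hr => F.rt_child (hF hr)
  have hnT : ∀ {r}, T r → ¬ T (nx r) := by
    intro r hr hn
    have := hn.1
    rw [hG hr] at this
    simp at this
  have hTT : ∀ {r r'}, T r → G.par r' = none → F.rt r = F.rt r' → r = r' :=
    fun hr hr' => h.root_unique hr.1 hr'
  -- The new root `nx r` gets rank `0` and all other ranks are the old depths plus one, so the
  -- reversed pointer decreases the rank and the old pointers still do.
  obtain ⟨G', hG'⟩ := Forest.exists_of_rank (N := N)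
    (fun v => if T v then some (nx v) else if ∃ r, T r ∧ v = nx r then none else G.par v)
    (fun v => if ∃ r, T r ∧ v = nx r then 0 else G.dep v + 1) (by
      intro v u huv
      split_ifs at huv with h1 h2
      · cases huv
        refine ⟨(F.adj (hF h1)).symm, ?_⟩
        rw [if_pos ⟨v, h1, rfl⟩, if_neg]
        · omega
        · rintro ⟨r, hr, rfl⟩
          exact hnT hr h1
      · refine ⟨G.adj huv, ?_⟩
        have := G.dep_child huv
        rw [if_neg h2]
        split_ifs <;> omega)
  have e1 : ∀ {v}, T v → G'.par v = some (nx v) := fun h1 => by rw [hG']; exact if_pos h1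
  have e2 : ∀ {r}, T r → G'.par (nx r) = none := fun {r} h1 => by
    rw [hG']
    dsimp only
    rw [if_neg (hnT h1), if_pos ⟨r, h1, rfl⟩]
  have e3 : ∀ {v}, ¬ T v → (∀ r, T r → v ≠ nx r) → G'.par v = G.par v := fun {v} h1 h2 => by
    rw [hG']
    dsimp only
    rw [if_neg h1, if_neg]
    rintro ⟨r, hr, hv⟩
    exact h2 r hr hv
  have cases : ∀ v, T v ∨ (∃ r, T r ∧ v = nx r) ∨ (¬ T v ∧ ∀ r, T r → v ≠ nx r) := by
    intro v
    by_cases h1 : T v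
    · exact Or.inl h1
    · by_cases h2 : ∃ r, T r ∧ v = nx r
      · exact Or.inr (Or.inl h2)
      · exact Or.inr (Or.inr ⟨h1, fun r hr hv => h2 ⟨r, hr, hv⟩⟩)
  have root_cases : ∀ {r}, G'.par r = none →
      (∃ r', T r' ∧ r = nx r') ∨ (G.par r = none ∧ ¬ T r) := by
    intro r hr
    rcases cases r with h1 | h1 | ⟨h1, h2⟩
    · rw [e1 h1] at hr; simp at hr
    · exact Or.inl h1
    · exact Or.inr ⟨by rwa [e3 h1 h2] at hr, h1⟩
  refine ⟨G', ⟨?_, ?_, ?_, ?_, ?_, ?_, ?_⟩, nx, ?_, ?_⟩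
  · intro v u huv
    rcases cases v with h1 | ⟨r, hr, rfl⟩ | ⟨h1, h2⟩
    · rw [e1 h1] at huv
      cases huv
      exact (hrt h1).symm
    · rw [e2 hr] at huv; simp at huv
    · rw [e3 h1 h2] at huv; exact h.rt_eq huv
  · intro r r' hr hr' hrr
    rcases root_cases hr with ⟨s, hs, rfl⟩ | ⟨h1, h2⟩ <;>
      rcases root_cases hr' with ⟨s', hs', rfl⟩ | ⟨h1', h2'⟩
    · rw [hrt hs, hrt hs'] at hrr
      rw [hTT hs hs'.1 hrr]
    · rw [hrt hs] at hrr
      exact absurd (hTT hs h1' hrr ▸ hs) h2'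
    · rw [hrt hs'] at hrr
      exact absurd (hTT hs' h1 hrr.symm ▸ hs') h2
    · exact h.root_unique h1 h1' hrr
  · intro v hv
    rw [e3 (fun h1 => hv h1.2.1), h.par_eq hv]
    rintro r hr rfl
    exact hv ((small_congr (hrt hr)).2 hr.2.1)
  · intro r hr hs
    rcases root_cases hr with ⟨s, hs', rfl⟩ | ⟨h1, h2⟩
    · rw [S.inner_congr _ _ (hrt hs')]
      exact hD hs'
    · exact h.desc h1 hs
  · intro r hr hs
    rcases root_cases hr with ⟨s, hs', rfl⟩ | ⟨h1, h2⟩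
    · right
      -- Each transfer moves the root one level down in `F`.
      have := (h.progress hs'.1 hs'.2.1).resolve_left hs'.2.2
      have := F.dep_child (hF hs')
      omega
    · left
      by_contra hn
      exact h2 ⟨h1, hs, hn⟩
  · intro r v hr hs hv hvr
    have hrtv := hv.rt_eq
    rcases root_cases hr with ⟨s, hs', rfl⟩ | ⟨h1, h2⟩
    · have hlt := hv.eq_or_lt.resolve_left hvr
      have hd := F.dep_child (hF hs')
      have hvs : v ≠ s := by rintro rfl; omega
      have hb := h.below hs'.1 hs'.2.1 (hv.parent (hF hs')) hvs
      rw [← hb]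
      refine e3 (fun h1 => ?_) (fun r1 hr1 hv1 => ?_)
      · have h2 := h1.1
        rw [hb] at h2
        have := F.dep_root h2
        omega
      · subst hv1
        rw [hrt hr1, hrt hs'] at hrtv
        exact hvr (by rw [hTT hr1 hs'.1 hrtv])
    · rw [← h.below h1 hs hv hvr]
      refine e3 (fun h3 => ?_) (fun r1 hr1 hv1 => ?_)
      · exact hvr (hTT h3 h1 hrtv)
      · subst hv1
        rw [hrt hr1] at hrtv
        exact h2 (hTT hr1 h1 hrtv ▸ hr1)
  · intro v u huv
    rcases cases v with h1 | ⟨r, hr, rfl⟩ | ⟨h1, h2⟩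
    · rw [e1 h1] at huv
      cases huv
      exact (S.light _ _ (hF h1)).symm
    · rw [e2 hr] at huv; simp at huv
    · rw [e3 h1 h2] at huv; exact h.light huv
  · intro r h1 h2 h3
    obtain ⟨e, k1, k2, -⟩ := hnx r ⟨h1, h2, h3⟩
    exact ⟨e, k1, k2, hG ⟨h1, h2, h3⟩, e1 ⟨h1, h2, h3⟩, e2 ⟨h1, h2, h3⟩⟩
  · intro v h1 h2
    exact e3 h1 (fun r hr => h2 r hr.1 hr.2.1 hr.2.2)

/-- The bound on `k` marks the last round before hooking. The old root and its successor act in the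
same round: one points down while the other drops its pointer. -/
theorem Searched.run_transfer (S : N.Searched i F b c inner outer)
    (hrun : N.run (19 * 2 ^ i - 1) =
      (fun v => findState F i (2 ^ (i + 1) - 1) (Small F i) (c v) (b v) v))
    {k : ℕ} (hk : k ≤ 3 * 2 ^ i - 2) :
    ∃ G : Forest N, Transferred F G i k inner ∧
      N.run (19 * 2 ^ i + k) = fun v => transferState F G i k (c v) (inner v) (b v) v := by
  classical
  have hP : 0 < 2 ^ i := by positivity
  have hP' : 2 ^ (i + 1) = 2 * 2 ^ i := by rw [pow_succ]; ring
  induction k with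
  | zero =>
    refine ⟨F, S.transferred_zero, ?_⟩
    have h1 : 19 * 2 ^ i - 1 + 1 = 19 * 2 ^ i := by omega
    have hlive : N.Live (19 * 2 ^ i - 1) := by
      intro v
      rw [hrun]
      refine ⟨S.done v, ?_⟩
      simp only [findState]
      omega
    ext1 v
    have := run_startTransfer (i := i) hlive h1 v
    rw [h1, hrun] at this
    rw [add_zero, this]
    have ha := S.active v
    have hpar := (S.rep v).2
    by_cases hv : F.par v = none ∧ Small F i v
    · have hm := S.mustTransfer_eq hv.2 (S.transferred_zero.desc hv.1 hv.2)
        (s := (findState F i (2 ^ (i + 1) - 1) (Small F i) (c v) (b v) v).tick (19 * 2 ^ i))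
        (S.rep v).1 rfl
      have hm' : ((findState F i (2 ^ (i + 1) - 1) (Small F i) (c v) (b v) v).tick
          (19 * 2 ^ i)).mustTransfer = decide (v ≠ inner v) := by
        rw [Bool.eq_iff_iff, hm, decide_eq_true_eq]
      unfold NodeState.startTransfer
      beta_reduce
      rw [hm']
      simp [NodeState.tick, findState, transferState, ha, hv, hpar]
    · have hv' : ¬ (F.par v = none ∧ Small F i v ∧ v ≠ inner v) := fun h => hv ⟨h.1, h.2.1⟩
      simp [NodeState.startTransfer, NodeState.tick, findState, transferState, ha, hv, hv', hpar,
        S.transfer v]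
  | succ k ih =>
    obtain ⟨G, hG, hr⟩ := ih (by omega)
    obtain ⟨G', hG', nx, h1, h2⟩ := S.exists_transferred_succ hG
    refine ⟨G', hG', ?_⟩
    have hlive : N.Live (19 * 2 ^ i + k) := by
      intro v; rw [hr]; exact ⟨S.done v, rfl⟩
    have hrep : G.Rep (N.run (19 * 2 ^ i + k)) := by
      intro v; rw [hr]; exact ⟨(S.rep v).1, rfl⟩
    ext1 v
    rw [← add_assoc, N.run_rootTransfer (i := i) hlive (by omega) (by omega)]
    have hps := parentState_tick hrep v (19 * 2 ^ i + k + 1)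
    have hstate : (N.run (19 * 2 ^ i + k) v).tick (19 * 2 ^ i + k + 1) =
        transferState F G i (k + 1) (c v) (inner v) (b v) v := by
      rw [hr]; rfl
    rw [hstate] at hps ⊢
    generalize N.view (N.run (19 * 2 ^ i + k)) v = nb at hps
    rw [hr] at hps
    unfold NodeState.rootTransfer
    by_cases hT : G.par v = none ∧ Small F i v ∧ v ≠ inner v
    · obtain ⟨e, k1, k2, -, k4, -⟩ := h1 v hT.1 hT.2.1 hT.2.2
      rw [if_pos (by simp only [transferState, decide_eq_true_eq]; exact hT)]
      have hc : (transferState F G i (k + 1) (c v) (inner v) (b v) v).cand = e := k1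
      rw [hc]
      simp [transferState, k4, k2, k1]
    rw [if_neg (by simp only [transferState, decide_eq_true_eq]; exact hT), hps]
    cases hp : G.par v with
    | none =>
      have : G'.par v = G.par v := by
        refine h2 v hT fun r k1 k2 k3 hv => ?_
        obtain ⟨e, -, -, k4, -⟩ := h1 r k1 k2 k3
        rw [← hv, hp] at k4
        simp at k4
      simp [transferState, this]
    | some p =>
      simp only [Option.map_some]
      by_cases hTp : (G.par p = none ∧ Small F i p ∧ p ≠ inner p) ∧ v = nx p
      · obtain ⟨⟨j1, j2, j3⟩, rfl⟩ := hTp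
        obtain ⟨e, k1, k2, -, -, k5⟩ := h1 p j1 j2 j3
        have hc : (transferState F G i k (c p) (inner p) (b p) p).cand = e := k1
        rw [hc]
        have hrt : F.rt (nx p) = F.rt p := hG.rt_eq hp
        have hs : Small F i (nx p) := (small_congr hrt).2 j2
        have hm := S.mustTransfer_eq hs (hG'.desc k5 hs)
          (s := transferState F G i (k + 1) (c (nx p)) (inner (nx p)) (b (nx p)) (nx p))
          (S.rep _).1 rfl
        have hm' : (transferState F G i (k + 1) (c (nx p)) (inner (nx p)) (b (nx p))
            (nx p)).mustTransfer = decide (nx p ≠ inner (nx p)) := by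
          rw [Bool.eq_iff_iff, hm, decide_eq_true_eq]
        have htr : (transferState F G i k (c p) (inner p) (b p) p).transfer = true := by
          simp only [transferState, decide_eq_true_eq]; exact ⟨j1, j2, j3⟩
        have hid : e.next = (transferState F G i (k + 1) (c (nx p)) (inner (nx p)) (b (nx p))
            (nx p)).id := by
          rw [k2]; exact ((S.rep _).1).symm
        show (if _ then _ else _) = _
        rw [if_pos ⟨htr, hid⟩, hm']
        simp [transferState, k5, hs]
      · have hpar : G'.par v = G.par v := by
          refine h2 v hT fun r k1 k2 k3 hv => hTp ?_
          obtain ⟨e, -, -, k4, -⟩ := h1 r k1 k2 k3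
          rw [← hv, hp] at k4
          cases k4
          exact ⟨⟨k1, k2, k3⟩, hv⟩
        have hsame : transferState F G i (k + 1) (c v) (inner v) (b v) v =
            transferState F G' i (k + 1) (c v) (inner v) (b v) v := by
          simp [transferState, hpar]
        rw [← hsame]
        rcases hc : (transferState F G i k (c p) (inner p) (b p) p).cand with _ | e
        · rfl
        · show (if _ then _ else _) = _
          rw [if_neg]
          rintro ⟨j1, j2⟩
          simp only [transferState, decide_eq_true_eq] at j1
          obtain ⟨e', k1, k2, -⟩ := h1 p j1.1 j1.2.1 j1.2.2
          refine hTp ⟨j1, N.id_injective ?_⟩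
          have : e' = e := by
            have := k1.symm.trans hc
            exact WithTop.coe_injective this
          rw [← k2, this, j2]
          exact ((S.rep v).1).symm

end Network

end SyncMST

namespace SyncMST

namespace Network

variable {V : Type*} [Fintype V] {N : Network V} {t i : ℕ} {F : Forest N} {b : V → NodeState}
  {c : V → WithTop Candidate} {inner outer : V → V}

/-- Every node of a small tree stores level `i`, so a new root already has the right level; the
other trees have not changed. -/
theorem Searched.good_transferState (S : N.Searched i F b c inner outer) {G : Forest N} {k : ℕ}
    (h : Transferred F G i k inner)
    (hrun : N.run t = fun v => transferState F G i k (c v) (inner v) (b v) v) : N.Good t := by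
  refine ⟨G, fun v => ?_, fun r hr => ?_, fun v m hm => ?_⟩
  · rw [hrun]; exact ⟨(S.rep v).1, rfl⟩
  · rw [hrun]
    refine le_trans ?_ (size_mono (fun _ _ => h.rt_congr) r)
    show 2 ^ (b r).level ≤ _
    by_cases hs : Small F i r
    · rw [(S.small r hs).2.2]; exact S.size r
    · exact S.level r (by rw [← h.par_eq hs, hr])
  · rw [hrun] at hm
    exact S.count v m hm

/-! ### Merging -/

/-- The root `v` of a small tree hooks upon the other endpoint of its candidate edge. -/
def Hooks (N : Network V) (F G : Forest N) (i : ℕ) (outer : V → V) (v : V) : Prop :=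
  G.par v = none ∧ Small F i v ∧ ¬ (G.par (outer v) = none ∧ Small F i (outer v) ∧
    outer (outer v) = v ∧ N.id (outer v) < N.id v)

-- The node has already ticked, so its clock `k'` may differ from the clock `k` of the neighbours it
-- reads. As the roots of small trees sit at the inner endpoints, `isPivotOf` tells whether both
-- trees chose the same edge.
open Classical in
theorem Searched.hook_transferState (S : N.Searched i F b c inner outer) {G : Forest N} {k : ℕ}
    (hin : ∀ r, G.par r = none → Small F i r → r = inner r) (k' : ℕ) (v : V) :
    (transferState F G i k' (c v) (inner v) (b v) v).hook
      (N.view (fun v => transferState F G i k (c v) (inner v) (b v) v) v) =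
      { transferState F G i k' (c v) (inner v) (b v) v with
        parent := (if Hooks N F G i outer v then some (outer v) else G.par v).map N.id } := by
  unfold NodeState.hook
  by_cases hv : G.par v = none ∧ Small F i v
  swap
  · rw [if_neg (by simp only [transferState, decide_eq_true_eq]; exact hv),
      if_neg (fun h => hv ⟨h.1, h.2.1⟩)]
    rfl
  rw [if_pos (by simp only [transferState, decide_eq_true_eq]; exact hv)]
  have hm := S.minEdge v hv.2
  rw [← hin v hv.1 hv.2] at hm
  obtain ⟨e, he, -, h2, -⟩ := hm.cand_eq (Forest.Desc.refl v) (S.best v hv.2)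
  have hc : (transferState F G i k' (c v) (inner v) (b v) v).cand = e := he
  have hid : ∀ v, ((fun v => transferState F G i k (c v) (inner v) (b v) v) v).id = N.id v :=
    fun v => (S.rep v).1
  rw [hc]
  show (match NodeState.lookup (N.view _ v) e.outer with | none => _ | some x => _) = _
  rw [h2, lookup_view hid hm.adj]
  have hpiv : (NodeState.isPivotOf (transferState F G i k' (c v) (inner v) (b v) v)
      (transferState F G i k (c (outer v)) (inner (outer v)) (b (outer v)) (outer v)) = true) ↔
      (G.par (outer v) = none ∧ Small F i (outer v)) ∧ outer (outer v) = v := by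
    unfold NodeState.isPivotOf
    by_cases hx : G.par (outer v) = none ∧ Small F i (outer v)
    · have hmx := S.minEdge _ hx.2
      rw [← hin _ hx.1 hx.2] at hmx
      obtain ⟨e', he', k1, k2, -⟩ := hmx.cand_eq (Forest.Desc.refl _) (S.best _ hx.2)
      have hcx : (transferState F G i k (c (outer v)) (inner (outer v)) (b (outer v))
          (outer v)).cand = e' := he'
      rw [hcx]
      have i1 : (transferState F G i k (c (outer v)) (inner (outer v)) (b (outer v))
          (outer v)).id = N.id (outer v) := (S.rep _).1
      have i2 : (transferState F G i k' (c v) (inner v) (b v) v).id = N.id v := (S.rep _).1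
      have i3 : (transferState F G i k (c (outer v)) (inner (outer v)) (b (outer v))
          (outer v)).active = true := by
        simp only [transferState, decide_eq_true_eq]; exact hx
      show (_ && _ && _) = true ↔ _
      rw [i1, i2, i3, k1, k2]
      simp [hx, N.id_injective.eq_iff]
    · rcases (transferState F G i k (c (outer v)) (inner (outer v)) (b (outer v))
        (outer v)).cand with _ | e'
      · simp [hx]
      · simp [transferState, hx]
  have i1 : (transferState F G i k (c (outer v)) (inner (outer v)) (b (outer v))
      (outer v)).id = N.id (outer v) := (S.rep _).1
  have i2 : (transferState F G i k' (c v) (inner v) (b v) v).id = N.id v := (S.rep _).1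
  show (if _ then _ else _) = _
  rw [i1, i2]
  by_cases hh : Hooks N F G i outer v
  · rw [if_neg, if_pos hh]
    · rw [← hc, ← i2]; rfl
    · rintro ⟨k1, k2⟩
      have := hpiv.1 k1
      exact hh.2.2 ⟨this.1.1, this.1.2, this.2, k2⟩
  · rw [if_pos, if_neg hh]
    · rfl
    · by_contra hn
      refine hh ⟨hv.1, hv.2, fun hk => hn ⟨hpiv.2 ⟨⟨hk.1, hk.2.1⟩, hk.2.2.1⟩, hk.2.2.2⟩⟩

open Classical in
/-- Hooking merges the trees of a forest into larger trees. -/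
theorem Searched.exists_hooked (S : N.Searched i F b c inner outer) {G : Forest N} {k : ℕ}
    (h : Transferred F G i k inner)
    (hin : ∀ r, G.par r = none → Small F i r → r = inner r) :
    ∃ G' : Forest N,
      (∀ v, G'.par v = if Hooks N F G i outer v then some (outer v) else G.par v) ∧
      (∀ u v, F.rt u = F.rt v → G'.rt u = G'.rt v) ∧
      (∀ v, 2 ^ (i + 1) ≤ G'.size v) ∧
      (∀ v u, G'.par v = some u → N.Light v u) := by
  have hm : ∀ v, Hooks N F G i outer v → MinEdge F v v (outer v) := by
    intro v hv
    have := S.minEdge v hv.2.1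
    rwa [← hin v hv.1 hv.2.1] at this
  obtain ⟨D, hD⟩ : ∃ D, ∀ v, G.dep v ≤ D :=
    ⟨Finset.univ.sup G.dep, fun v => Finset.le_sup (Finset.mem_univ v)⟩
  -- The rank is lexicographic: first the candidate weight of the tree (`0` if it does not hook),
  -- then the depth, which `D` bounds.
  set val : V → ℕ := fun r =>
    if Hooks N F G i outer r then 1 + N.weight s(r, outer r) else 0 with hval
  obtain ⟨G', hG'⟩ := Forest.exists_of_rank (N := N)
    (fun v => if Hooks N F G i outer v then some (outer v) else G.par v)
    (fun v => val (G.rt v) * (D + 1) + G.dep v) (by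
      intro v u huv
      split_ifs at huv with hv
      · cases huv
        have hmv := hm v hv
        refine ⟨hmv.adj, ?_⟩
        rw [G.rt_root hv.1, G.dep_root hv.1]
        have hlt : val (G.rt (outer v)) < val v := by
          simp only [hval]
          rw [if_pos hv]
          split_ifs with hr
          swap
          · omega
          have hmr := hm _ hr
          have hrt := h.rt_rt (outer v)
          -- The edge to `v` leaves the tree of `outer v`, so the candidate of that tree weighs no
          -- more.
          have hle := hmr.le (outer v) v hrt.symm
            (by rw [hrt]; exact fun h => hmv.rt_right h.symm) hmv.adj.symm
          rw [Sym2.eq_swap (a := outer v)] at hle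
          -- Equal weights mean that both trees chose the same edge. Then `outer v` is a root as
          -- well, and the identity rule forbids one of the two hooks.
          refine Nat.add_lt_add_left (lt_of_le_of_ne hle fun heq => ?_) 1
          obtain ⟨h1, h2⟩ := hmr.eq hrt.symm (by rw [hrt]; exact fun h => hmv.rt_right h.symm)
            hmv.adj.symm (by rw [Sym2.eq_swap (a := outer v)]; exact heq.ge)
          rw [← h1] at h2 hr
          have hne : N.id v ≠ N.id (outer v) := N.id_injective.ne hmv.adj.ne
          have h3 : ¬ N.id (outer v) < N.id v := fun h4 =>
            hv.2.2 ⟨hr.1, hr.2.1, h2.symm, h4⟩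
          refine hr.2.2 ?_
          rw [← h2]
          exact ⟨hv.1, hv.2.1, rfl, by omega⟩
        have := hD (outer v)
        nlinarith
      · refine ⟨G.adj huv, ?_⟩
        rw [G.rt_child huv, G.dep_child huv]
        omega)
  have hpar : ∀ v, G'.par v = if Hooks N F G i outer v then some (outer v) else G.par v :=
    fun v => congrFun hG' v
  have hrt : ∀ u v, F.rt u = F.rt v → G'.rt u = G'.rt v := by
    have key : ∀ v, G'.rt (G.rt v) = G'.rt v := by
      refine G.apply_rt G'.rt fun v u huv => G'.rt_child ?_
      rw [hpar, if_neg, huv]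
      intro hv
      rw [hv.1] at huv
      simp at huv
    intro u v huv
    rw [← key u, ← key v, h.rt_congr huv]
  refine ⟨G', hpar, hrt, fun v => ?_, fun v u huv => ?_⟩
  · rw [← Forest.size_eq (G'.rt_rt v)]
    have hr := G'.par_rt v
    generalize G'.rt v = r at hr
    have hnh : ¬ Hooks N F G i outer r := by
      intro hh
      rw [hpar, if_pos hh] at hr
      simp at hr
    have hGr : G.par r = none := by rwa [hpar, if_neg hnh] at hr
    by_cases hs : Small F i r
    · have hx : G.par (outer r) = none ∧ Small F i (outer r) ∧
          outer (outer r) = r ∧ N.id (outer r) < N.id r := by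
        by_contra hn
        exact hnh ⟨hGr, hs, hn⟩
      have hxh : Hooks N F G i outer (outer r) := by
        refine ⟨hx.1, hx.2.1, ?_⟩
        rw [hx.2.2.1]
        rintro ⟨-, -, -, h1⟩
        exact absurd hx.2.2.2 (by omega)
      have hxr : G'.rt (outer r) = G'.rt r := by
        apply G'.rt_child
        rw [hpar, if_pos hxh, hx.2.2.1]
      have hne : F.rt (outer r) ≠ F.rt r := (S.minEdge r hs).rt_right
      have hdisj : Disjoint {u | F.rt u = F.rt r} {u | F.rt u = F.rt (outer r)} := by
        rw [Set.disjoint_left]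
        intro u hu hu'
        exact hne (hu'.symm.trans hu)
      have hsub : {u | F.rt u = F.rt r} ∪ {u | F.rt u = F.rt (outer r)} ⊆
          {u | G'.rt u = G'.rt r} := by
        rintro u (hu | hu)
        · exact hrt u r hu
        · exact (hrt u _ hu).trans hxr
      have h1 := Set.ncard_le_ncard hsub (Set.toFinite _)
      rw [Set.ncard_union_eq hdisj (Set.toFinite _) (Set.toFinite _)] at h1
      have h2 := S.size r
      have h3 := S.size (outer r)
      unfold Forest.size at h2 h3 ⊢
      rw [pow_succ]
      omega
    · refine le_trans ?_ (size_mono hrt r)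
      unfold Small at hs
      omega
  · rw [hpar] at huv
    split_ifs at huv with hv
    · cases huv
      exact (hm v hv).light
    · exact h.light huv

/-- A phase in which no root terminates leads to the next phase. -/
theorem Counted.next_phase (C : N.Counted i F b) (hl : N.Live (15 * 2 ^ i - 1))
    (hb : N.run (15 * 2 ^ i - 1) = b) :
    (∃ F', N.PhaseStart (i + 1) F') ∧ ∀ t, 15 * 2 ^ i - 1 ≤ t → t < 22 * 2 ^ i → N.Good t := by
  classical
  have hP : 0 < 2 ^ i := by positivity
  have hP' : 2 ^ (i + 1) = 2 * 2 ^ i := by rw [pow_succ]; ring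
  obtain ⟨c, hrun, hc1, hc2⟩ := C.run_found hl hb
  obtain ⟨inner, outer, S⟩ := C.searched hc1 hc2
  obtain ⟨G, hG, hrG⟩ := S.run_transfer hrun (k := 3 * 2 ^ i - 2) le_rfl
  -- A root still on its way would have depth at least `3 * 2 ^ i - 2`, more than a small tree
  -- allows.
  have hin : ∀ r, G.par r = none → Small F i r → r = inner r := by
    intro r hr hs
    refine (hG.progress hr hs).resolve_right fun hle => ?_
    have := (C.small r hs).1
    omega
  have ht : 19 * 2 ^ i + (3 * 2 ^ i - 2) = 22 * 2 ^ i - 2 := by omega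
  have hlive : N.Live (22 * 2 ^ i - 2) := by
    intro v
    rw [← ht, hrG]
    exact ⟨C.done v, rfl⟩
  obtain ⟨G', hpar, hrt, hsize, hlight⟩ := S.exists_hooked hG hin
  have hlast : N.run (22 * 2 ^ i - 1) = fun v =>
      { transferState F G i (3 * 2 ^ i - 1) (c v) (inner v) (b v) v with
        parent := (G'.par v).map N.id } := by
    ext1 v
    have h1 : 22 * 2 ^ i - 2 + 1 = 22 * 2 ^ i - 1 := by omega
    have := run_hook (i := i) hlive h1 v
    rw [h1, ← ht, hrG] at this
    rw [this, hpar, ← S.hook_transferState hin]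
    congr 1
    simp only [NodeState.tick, transferState]
    congr 1
    omega
  have hend : 11 * 2 ^ (i + 1) - 1 = 22 * 2 ^ i - 1 := by omega
  have hlev : ∀ v, G'.par v = none → 2 ^ (b v).level ≤ G'.size v := by
    intro v hv
    by_cases hs : Small F i v
    · rw [(C.small v hs).2.2]
      have := hsize v
      omega
    · refine le_trans (C.level v ?_) (size_mono hrt v)
      rw [← hG.par_eq hs]
      rwa [hpar, if_neg (fun h => hs h.2.1)] at hv
  refine ⟨⟨G', ?_, ?_, hsize, ?_, ?_, hlight⟩, fun t h1 h2 => ?_⟩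
  · rw [hend]
    intro v
    rw [hlast]
    refine ⟨C.done v, ?_⟩
    simp only [transferState]
    omega
  · rw [hend]
    intro v
    rw [hlast]
    exact ⟨(C.rep v).1, rfl⟩
  · rw [hend, hlast]
    exact hlev
  · rw [hend, hlast]
    intro v
    obtain ⟨y, h1, h2⟩ := C.rootId v
    -- Old estimates stay valid because trees are only merged, never split.
    exact ⟨y, h1, hrt _ _ h2⟩
  · rcases Nat.lt_or_ge t (15 * 2 ^ i) with h3 | h3
    · refine good_of_counted C fun v => ?_
      obtain rfl : t = 15 * 2 ^ i - 1 := by omega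
      rw [hb]
      exact ⟨rfl, rfl, rfl, rfl⟩
    rcases Nat.lt_or_ge t (17 * 2 ^ i) with h4 | h4
    · refine good_of_counted C fun v => ?_
      obtain ⟨k, rfl⟩ := Nat.exists_eq_add_of_le h3
      rw [C.run_findWave hl hb (by omega)]
      exact ⟨rfl, rfl, rfl, rfl⟩
    rcases Nat.lt_or_ge t (19 * 2 ^ i) with h5 | h5
    · refine good_of_counted C fun v => ?_
      obtain ⟨k, rfl⟩ := Nat.exists_eq_add_of_le h4
      obtain ⟨h, c', -, hr, -⟩ := C.run_findEcho hl hb (k := k) (by omega)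
      rw [hr]
      exact ⟨rfl, rfl, rfl, rfl⟩
    rcases Nat.lt_or_ge t (22 * 2 ^ i - 1) with h6 | h6
    · obtain ⟨k, rfl⟩ := Nat.exists_eq_add_of_le h5
      obtain ⟨G1, hG1, hr1⟩ := S.run_transfer hrun (k := k) (by omega)
      exact S.good_transferState hG1 hr1
    · obtain rfl : t = 22 * 2 ^ i - 1 := by omega
      refine ⟨G', fun v => ?_, ?_, ?_⟩ <;> rw [hlast]
      · exact ⟨(C.rep v).1, rfl⟩
      · exact hlev
      · exact C.count

/-! ### The whole execution -/

/-- From round `T` on, all nodes have terminated, with a minimum spanning tree. -/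
def Finished (N : Network V) (T : ℕ) : Prop :=
  ∀ t, T ≤ t → (∀ v, (N.run t v).done = true) ∧ N.IsMST (N.output t)

/-- The alternative is whether some root covers at some moment of the counting echo. If so, the
phase is the last; otherwise the echo is completed and the search follows. -/
theorem PhaseStart.phase (H : N.PhaseStart i F) :
    (∀ t, 11 * 2 ^ i ≤ t → t < 22 * 2 ^ i → N.Good t) ∧
      ((∃ F', N.PhaseStart (i + 1) F') ∨
        (∀ t, 11 * 2 ^ i ≤ t → N.Good t) ∧ N.Finished (22 * 2 ^ i - 1)) := by
  have hP : 0 < 2 ^ i := by positivity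
  have hP' : 2 ^ (i + 1) = 2 * 2 ^ i := by rw [pow_succ]; ring
  have hwave : ∀ t, 11 * 2 ^ i ≤ t → t < 13 * 2 ^ i → N.Good t := by
    intro t h1 h2
    obtain ⟨k, rfl⟩ := Nat.exists_eq_add_of_le h1
    exact H.good_wave (by omega)
  by_cases hfin : ∃ k ≤ 2 * 2 ^ i, ∃ h, F.Echo (Reached F i) (2 ^ (i + 1) - 1) k h ∧
      N.run (13 * 2 ^ i - 1 + k) =
        (fun v => echoState F i k h (N.run (11 * 2 ^ i - 1) v) v) ∧
      ∃ r, F.par r = none ∧ h r ∧ F.Covers (2 ^ (i + 1) - 1) r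
  · have hecho : ∀ t, 13 * 2 ^ i ≤ t → N.Good t := by
      intro t ht
      by_cases hk : t ≤ 15 * 2 ^ i - 1
      · obtain ⟨k, rfl⟩ := Nat.exists_eq_add_of_le (show 13 * 2 ^ i - 1 ≤ t by omega)
        obtain ⟨k', hk', h, hE, hrun, ⟨rfl, -⟩ | ⟨r, h1, h2, h3⟩⟩ :=
          H.run_echo (k := k) (by omega)
        · exact good_of_echoState H hrun
        · exact (H.finish_of_covers (by omega) hE hrun h1 h2 h3).1 _ (by omega)
      · obtain ⟨k, hk, h, hE, hrun, r, h1, h2, h3⟩ := hfin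
        exact (H.finish_of_covers hk hE hrun h1 h2 h3).1 _ (by omega)
    have hall : ∀ t, 11 * 2 ^ i ≤ t → N.Good t := by
      intro t ht
      rcases Nat.lt_or_ge t (13 * 2 ^ i) with h | h
      · exact hwave t ht h
      · exact hecho t h
    refine ⟨fun t h1 _ => hall t h1, Or.inr ⟨hall, ?_⟩⟩
    obtain ⟨k, hk, h, hE, hrun, r, h1, h2, h3⟩ := hfin
    exact (H.finish_of_covers hk hE hrun h1 h2 h3).2
  · have hstage : ∀ k ≤ 2 * 2 ^ i, ∃ h, F.Echo (Reached F i) (2 ^ (i + 1) - 1) k h ∧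
        N.run (13 * 2 ^ i - 1 + k) =
          (fun v => echoState F i k h (N.run (11 * 2 ^ i - 1) v) v) ∧
        N.Live (13 * 2 ^ i - 1 + k) := by
      intro k hk
      obtain ⟨k', hk', h, hE, hrun, ⟨rfl, hl⟩ | hr⟩ := H.run_echo hk
      · exact ⟨h, hE, hrun, hl⟩
      · exact absurd ⟨k', by omega, h, hE, hrun, hr⟩ hfin
    obtain ⟨h, hE, hrun, hl⟩ := hstage _ le_rfl
    have h15 : 13 * 2 ^ i - 1 + 2 * 2 ^ i = 15 * 2 ^ i - 1 := by omega
    -- The `2 * 2 ^ i` rounds exceed the depth bound by one, so every reached node has echoed.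
    have hh : h = Reached F i := by
      ext v
      exact ⟨hE.mem, fun hv => hE.progress hv (by omega)⟩
    subst hh
    rw [h15] at hrun hl
    obtain ⟨h1, h2⟩ := (H.counted hl hrun).next_phase hl rfl
    refine ⟨fun t ht ht' => ?_, Or.inl h1⟩
    rcases Nat.lt_or_ge t (13 * 2 ^ i) with h3 | h3
    · exact hwave t ht h3
    rcases Nat.lt_or_ge t (15 * 2 ^ i) with h4 | h4
    · obtain ⟨k, rfl⟩ := Nat.exists_eq_add_of_le (show 13 * 2 ^ i - 1 ≤ t by omega)
      obtain ⟨h, -, hr, -⟩ := hstage k (by omega)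
      exact good_of_echoState H hr
    · exact h2 t (by omega) ht'

/-- Before phase `0` nothing happens. -/
theorem run_of_lt {t : ℕ} (ht : t < 11) :
    N.run t = fun v => (NodeState.init (N.id v)).tick t := by
  induction t with
  | zero => rfl
  | succ t ih =>
    specialize ih (by omega)
    ext1 v
    show (N.run t v).step _ = _
    rw [ih]
    unfold NodeState.step
    simp [NodeState.init, NodeState.tick, NodeState.parentState, ht]

theorem good_of_lt {t : ℕ} (ht : t < 11) : N.Good t := by
  obtain ⟨F, hF⟩ := Forest.exists_singletons N
  refine ⟨F, fun v => ?_, fun r hr => ?_, fun v m hm => ?_⟩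
  · rw [run_of_lt ht, (hF v).1]; exact ⟨rfl, rfl⟩
  · rw [run_of_lt ht]; exact F.size_pos r
  · rw [run_of_lt ht] at hm; cases hm

theorem exists_phaseStart_zero : ∃ F, N.PhaseStart 0 F := by
  obtain ⟨F, hF⟩ := Forest.exists_singletons N
  have h10 : 11 * 2 ^ 0 - 1 = 10 := rfl
  refine ⟨F, ?_, ?_, fun v => F.size_pos v, ?_, ?_, fun v u h => ?_⟩
  · rw [h10]; intro v; rw [run_of_lt (by norm_num)]; exact ⟨rfl, rfl⟩
  · rw [h10]; intro v; rw [run_of_lt (by norm_num), (hF v).1]; exact ⟨rfl, rfl⟩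
  · rw [h10]; intro v _; rw [run_of_lt (by norm_num)]; exact F.size_pos v
  · rw [h10]; intro v; rw [run_of_lt (by norm_num)]; exact ⟨v, rfl, rfl⟩
  · rw [(hF v).1] at h; cases h

/-- The phases are executed one after another until one of them is the last. -/
theorem phases (i : ℕ) : (∃ F, N.PhaseStart i F) ∧ (∀ t, t < 11 * 2 ^ i → N.Good t) ∨
    ∃ j < i, (∃ F, N.PhaseStart j F) ∧ (∀ t, N.Good t) ∧ N.Finished (22 * 2 ^ j - 1) := by
  induction i with
  | zero => exact Or.inl ⟨exists_phaseStart_zero, fun t ht => good_of_lt (by simpa using ht)⟩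
  | succ i ih =>
    have hP' : 2 ^ (i + 1) = 2 * 2 ^ i := by rw [pow_succ]; ring
    rcases ih with ⟨⟨F, hF⟩, hg⟩ | ⟨j, hj, h⟩
    · rcases hF.phase with ⟨h1, h2 | ⟨h2, h3⟩⟩
      · refine Or.inl ⟨h2, fun t ht => ?_⟩
        rcases Nat.lt_or_ge t (11 * 2 ^ i) with h4 | h4
        · exact hg t h4
        · exact h1 t h4 (by omega)
      · refine Or.inr ⟨i, by omega, ⟨F, hF⟩, fun t => ?_, h3⟩
        rcases Nat.lt_or_ge t (11 * 2 ^ i) with h4 | h4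
        · exact hg t h4
        · exact h2 t h4
    · exact Or.inr ⟨j, by omega, h⟩

/-- A phase can start without terminated nodes only if `2 ^ i ≤ n`, and `n < 2 ^ n`, so this fails
for `i = n`. Hence some phase `j` with `2 ^ j ≤ n` is the last. -/
theorem good_and_finished (N : Network V) :
    (∀ t, N.Good t) ∧ ∃ T < 22 * Fintype.card V, N.Finished T := by
  obtain ⟨v⟩ := N.connected.nonempty
  have hle : ∀ i, (∃ F, N.PhaseStart i F) → 2 ^ i ≤ Fintype.card V := by
    rintro i ⟨F, hF⟩
    exact (hF.size v).trans (F.size_le_card v)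
  rcases N.phases (Fintype.card V) with ⟨h, -⟩ | ⟨j, -, hj, h1, h2⟩
  · have := hle _ h
    have := Nat.lt_two_pow_self (n := Fintype.card V)
    omega
  · have := hle _ hj
    have : 0 < 2 ^ j := by positivity
    exact ⟨h1, _, by omega, h2⟩

end Network

end SyncMST

namespace SyncMST

namespace Network

variable {V : Type*} {N : Network V} {K i : ℕ} {s : NodeState} {nb : Multiset Neighbour}

/-! ### Bounds on the registers -/

/-- All identities and weights in the memory `s` occur in the network, and the remaining registers,
except for the count, are bounded in terms of `K`. -/
structure Within (N : Network V) (K : ℕ) (s : NodeState) : Prop where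
  id : s.id ∈ Set.range N.id
  clock : s.clock ≤ K
  parent : ∀ p, s.parent = some p → p ∈ Set.range N.id
  rootId : s.rootId ∈ Set.range N.id
  level : 2 ^ s.level ≤ 2 * K + 1
  ttl : ∀ τ, s.ttl = some τ → τ ≤ 2 * K + 1
  cand : ∀ e : Candidate, s.cand = e → e.weight ∈ N.weight '' N.graph.edgeSet ∧
    e.inner ∈ Set.range N.id ∧ e.outer ∈ Set.range N.id ∧ e.next ∈ Set.range N.id

/-- The neighbourhood `nb` consists of edges and memories of the network. -/
def WithinNb (N : Network V) (K : ℕ) (nb : Multiset Neighbour) : Prop :=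
  ∀ x ∈ nb, x.weight ∈ N.weight '' N.graph.edgeSet ∧ N.Within K x.state

theorem Within.mono {K' : ℕ} (h : N.Within K s) (hK : K ≤ K') : N.Within K' s :=
  ⟨h.id, h.clock.trans hK, h.parent, h.rootId, h.level.trans (by omega),
    fun τ hτ => (h.ttl τ hτ).trans (by omega), h.cand⟩

theorem WithinNb.lookup (hn : N.WithinNb K nb) {a : ℕ} {p : NodeState}
    (hp : NodeState.lookup nb a = some p) : N.Within K p := by
  obtain ⟨-, x, hx, rfl⟩ := mem_of_lookup hp
  exact (hn x hx).2

theorem WithinNb.parentState (hn : N.WithinNb K nb) {p : NodeState}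
    (hp : s.parentState nb = some p) : N.Within K p := by
  obtain ⟨a, -, ha⟩ := Option.bind_eq_some_iff.1 hp
  exact hn.lookup ha

theorem Within.startPhase (h : N.Within K s) (hi : 2 ^ i ≤ K) : N.Within K (s.startPhase i) := by
  unfold NodeState.startPhase
  dsimp only
  have hi' : 2 ^ (i + 1) - 1 ≤ 2 * K + 1 := by rw [pow_succ]; omega
  split_ifs
  · refine ⟨h.id, h.clock, h.parent, h.id, by dsimp only; omega, ?_, ?_⟩
    · rintro τ ⟨⟩; exact hi'
    · intro e he; cases he
  · refine ⟨h.id, h.clock, h.parent, h.rootId, h.level, ?_, ?_⟩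
    · intro e he; cases he
    · intro e he; cases he

theorem Within.countWave (h : N.Within K s) (hn : N.WithinNb K nb) :
    N.Within K (s.countWave nb) := by
  unfold NodeState.countWave
  split_ifs
  swap
  · exact h
  split
  · exact h
  · rename_i p hp
    have hp' := hn.parentState hp
    split
    · rename_i τ hτ
      refine ⟨h.id, h.clock, h.parent, hp'.rootId, hp'.level, ?_, h.cand⟩
      rintro τ' ⟨⟩
      have := hp'.ttl _ hτ
      omega
    · exact h

theorem Within.countEcho (h : N.Within K s) (hi : 2 ^ i ≤ K) :
    N.Within K (s.countEcho i nb) := by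
  have hi' : 2 ^ (i + 1) ≤ 2 * K + 1 := by rw [pow_succ]; omega
  unfold NodeState.countEcho
  dsimp only
  split_ifs
  all_goals first
    | exact h
    | exact ⟨h.id, h.clock, h.parent, h.rootId, h.level, h.ttl, h.cand⟩
    | exact ⟨h.id, h.clock, h.parent, h.rootId, hi', h.ttl, h.cand⟩

theorem Within.startFind (h : N.Within K s) : N.Within K s.startFind := by
  unfold NodeState.startFind
  split_ifs
  · exact ⟨h.id, h.clock, h.parent, h.rootId, h.level, h.ttl, h.cand⟩
  · exact h

theorem Within.findWave (h : N.Within K s) (hn : N.WithinNb K nb) :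
    N.Within K (s.findWave nb) := by
  unfold NodeState.findWave
  split
  · exact h
  · rename_i p hp
    have hp' := hn.parentState hp
    split_ifs
    · exact ⟨h.id, h.clock, h.parent, hp'.rootId, hp'.level, h.ttl, h.cand⟩
    · exact h

theorem Within.findLocal (h : N.Within K s) (hn : N.WithinNb K nb) :
    N.Within K (s.findLocal nb) := by
  unfold NodeState.findLocal
  split_ifs
  swap
  · exact h
  refine ⟨h.id, h.clock, h.parent, h.rootId, h.level, h.ttl, ?_⟩
  intro e he
  dsimp only at he
  rcases Multiset.inf_eq_top_or_mem ((nb.filter (fun x => x.state.rootId ≠ s.rootId)).map (fun x =>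
    ((Candidate.mk x.weight s.id x.state.id x.state.id : Candidate) :
      WithTop Candidate))) with h2 | h2
  · rw [he] at h2; exact absurd h2 WithTop.coe_ne_top
  · rw [he] at h2
    obtain ⟨x, hx, hxe⟩ := Multiset.mem_map.1 h2
    have hx' := hn x (Multiset.mem_of_mem_filter hx)
    rw [← WithTop.coe_injective hxe]
    exact ⟨hx'.1, h.id, hx'.2.id, hx'.2.id⟩

theorem Within.findEcho (h : N.Within K s) (hn : N.WithinNb K nb) :
    N.Within K (s.findEcho nb) := by
  unfold NodeState.findEcho
  split_ifs
  swap
  · exact h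
  refine ⟨h.id, h.clock, h.parent, h.rootId, h.level, h.ttl, ?_⟩
  intro e he
  dsimp only at he
  set m := (s.children nb).map (fun u => WithTop.map (Candidate.via u.id) u.cand) with hm
  have hcases : s.cand = e ∨ m.inf = e := by
    rcases le_total s.cand m.inf with h1 | h1
    · left; rwa [inf_eq_left.2 h1] at he
    · right; rwa [inf_eq_right.2 h1] at he
  rcases hcases with h1 | h1
  · exact h.cand e h1
  · rcases Multiset.inf_eq_top_or_mem m with h2 | h2
    · rw [h1] at h2; exact absurd h2 WithTop.coe_ne_top
    · rw [h1] at h2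
      obtain ⟨u, hu, h3⟩ := Multiset.mem_map.1 h2
      obtain ⟨x, hx, rfl⟩ := Multiset.mem_map.1 (Multiset.mem_of_mem_filter hu)
      have hx' := (hn x hx).2
      obtain ⟨e', he', rfl⟩ : ∃ e' : Candidate, x.state.cand = e' ∧
          Candidate.via x.state.id e' = e := by
        rcases hdu : x.state.cand with _ | e'
        · rw [hdu] at h3; cases h3
        · rw [hdu] at h3; exact ⟨e', rfl, Option.some_injective _ h3⟩
      obtain ⟨k1, k2, k3, -⟩ := hx'.cand e' he'
      exact ⟨k1, k2, k3, hx'.id⟩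

theorem Within.startTransfer (h : N.Within K s) : N.Within K s.startTransfer := by
  unfold NodeState.startTransfer
  split_ifs
  · exact ⟨h.id, h.clock, h.parent, h.rootId, h.level, h.ttl, h.cand⟩
  · exact h

theorem Within.rootTransfer (h : N.Within K s) : N.Within K (s.rootTransfer nb) := by
  unfold NodeState.rootTransfer
  split_ifs
  · split
    · exact h
    · rename_i e he
      refine ⟨h.id, h.clock, ?_, h.rootId, h.level, h.ttl, h.cand⟩
      rintro p ⟨⟩
      exact (h.cand e he).2.2.2
  · split
    · exact h
    · split
      · exact h
      · split_ifs
        · refine ⟨h.id, h.clock, ?_, h.rootId, h.level, h.ttl, h.cand⟩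
          intro p hp; cases hp
        · exact h

theorem Within.hook (h : N.Within K s) (hn : N.WithinNb K nb) : N.Within K (s.hook nb) := by
  unfold NodeState.hook
  split_ifs
  swap
  · exact h
  split
  · exact h
  · split
    · exact h
    · rename_i x hx
      split_ifs
      · exact h
      · refine ⟨h.id, h.clock, ?_, h.rootId, h.level, h.ttl, h.cand⟩
        rintro p ⟨⟩
        exact (hn.lookup hx).id

theorem Within.step (h : N.Within K s) (hn : N.WithinNb K nb) : N.Within (K + 1) (s.step nb) := by
  have hn' : N.WithinNb (K + 1) nb := fun x hx => ⟨(hn x hx).1, (hn x hx).2.mono (by omega)⟩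
  have h' : N.Within (K + 1) { s with clock := s.clock + 1 } := by
    have h1 := h.mono (Nat.le_succ K)
    exact ⟨h1.id, Nat.succ_le_succ h.clock, h1.parent, h1.rootId, h1.level, h1.ttl, h1.cand⟩
  unfold NodeState.step
  dsimp only
  by_cases h1 : s.done = true
  · rw [if_pos h1]; exact h.mono (by omega)
  rw [if_neg h1]
  by_cases h2 : Option.any (fun p => p.done)
      (NodeState.parentState { s with clock := s.clock + 1 } nb) = true
  · rw [if_pos h2]
    exact ⟨h'.id, h'.clock, h'.parent, h'.rootId, h'.level, h'.ttl, h'.cand⟩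
  rw [if_neg h2]
  by_cases h3 : s.clock + 1 < 11
  · rw [if_pos h3]; exact h'
  rw [if_neg h3]
  have hi : 2 ^ Nat.log 2 ((s.clock + 1) / 11) ≤ K + 1 := by
    have h4 : (s.clock + 1) / 11 ≠ 0 := by omega
    have h5 := Nat.pow_log_le_self 2 h4
    have := h.clock
    omega
  split_ifs
  · exact h'.startPhase hi
  · exact h'.countWave hn'
  · exact h'.countEcho hi
  · exact h'.startFind
  · exact h'.findWave hn'
  · exact h'.findLocal hn'
  · exact h'.findEcho hn'
  · exact h'.startTransfer
  · exact h'.rootTransfer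
  · exact h'.hook hn'

/-- The bounds are local and need no forest. Numbers introduced in phase `i` are controlled by `2 ^
(i + 1)`, where `2 ^ i` is at most the round number, and copying preserves the bounds. -/
theorem within_run [Fintype V] (N : Network V) (t : ℕ) (v : V) : N.Within t (N.run t v) := by
  induction t generalizing v with
  | zero =>
    refine ⟨⟨v, rfl⟩, le_rfl, ?_, ⟨v, rfl⟩, le_rfl, ?_, ?_⟩ <;> intro e he <;> cases he
  | succ t ih =>
    refine Within.step (ih v) fun x hx => ?_
    obtain ⟨u, hu, rfl⟩ := mem_view.1 hx
    exact ⟨⟨s(v, u), hu, rfl⟩, ih u⟩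

/-! ### Memory size -/

theorem length_natCode (m : ℕ) : (NodeState.natCode m).length = 2 * m.size + 1 := by
  unfold NodeState.natCode
  rw [← Nat.size_eq_bits_len]
  simp [List.length_flatMap, mul_comm]

theorem length_encode_le {s : NodeState} {C : ℕ} (h : ∀ m ∈ s.regs, m.size ≤ C) :
    s.encode.length ≤ 18 * (2 * C + 1) := by
  have key : ∀ l : List ℕ, (∀ m ∈ l, m.size ≤ C) →
      (l.flatMap NodeState.natCode).length ≤ l.length * (2 * C + 1) := by
    intro l hl
    induction l with
    | nil => simp
    | cons a l ih =>
      rw [List.flatMap_cons, List.length_append, length_natCode, List.length_cons, add_mul, one_mul]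
      have h1 := ih fun m hm => hl m (List.mem_cons_of_mem _ hm)
      have h2 := hl a List.mem_cons_self
      omega
  have hlen : s.regs.length = 18 := by
    unfold NodeState.regs
    rcases s.cand with _ | e <;> rfl
  have := key s.regs h
  rwa [hlen] at this

theorem size_succ_le (m : ℕ) : (m + 1).size ≤ m.size + 1 := by
  rw [Nat.size_le, pow_succ]
  have := Nat.lt_size_self m
  omega

/-- The count needs its own hypothesis: a sum over children has no local bound, so its bound comes
from `Good`. -/
theorem length_encode_le_of_within {n k : ℕ} (hn : 0 < n) (hs : N.Within (22 * n) s)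
    (hc : ∀ c, s.count = some c → c ≤ n) (hid : ∀ v, (N.id v).size ≤ k * (Nat.log 2 n + 1))
    (hw : ∀ e ∈ N.graph.edgeSet, N.weight e ≤ k * n ^ k) :
    s.encode.length ≤ (18 * (4 * k + 15)) * (Nat.log 2 n + 1) := by
  set L := Nat.log 2 n + 1 with hL
  have hL1 : 1 ≤ L := by omega
  have hnL : n < 2 ^ L := Nat.lt_pow_succ_log_self (by norm_num) n
  have hid' : ∀ m ∈ Set.range N.id, m.size ≤ k * L := by
    rintro _ ⟨v, rfl⟩; exact hid v
  -- Time-to-live is at most `2 * (22 * n) + 1`, and `optReg` adds one; the result is at most `46 *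
  -- n`, below `2 ^ 6 * 2 ^ L`.
  have hsmall : ∀ m, m ≤ 46 * n → m.size ≤ L + 6 := by
    intro m hm
    rw [Nat.size_le, pow_add]
    omega
  have hbool : ∀ x : Bool, x.toNat.size ≤ L + 6 := by
    intro x
    apply hsmall
    have := x.toNat_le
    omega
  have hkL : k ≤ k * L := Nat.le_mul_of_pos_right k hL1
  have hweight : ∀ m ∈ N.weight '' N.graph.edgeSet, m.size ≤ k + k * L := by
    rintro _ ⟨e, he, rfl⟩
    rw [Nat.size_le]
    refine lt_of_le_of_lt (hw e he) ?_
    have h1 : n ^ k ≤ 2 ^ (k * L) := by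
      rw [mul_comm, pow_mul]
      exact Nat.pow_le_pow_left hnL.le k
    rw [pow_add]
    exact lt_of_le_of_lt (Nat.mul_le_mul_left k h1)
      (Nat.mul_lt_mul_of_pos_right Nat.lt_two_pow_self (by positivity))
  have hlevel : s.level.size ≤ L + 6 := by
    apply hsmall
    have h1 := hs.level
    have h2 := Nat.lt_two_pow_self (n := s.level)
    omega
  have hclock : s.clock.size ≤ L + 6 := hsmall _ (by have := hs.clock; omega)
  have hparent : (NodeState.optReg s.parent).size ≤ k * L + 1 := by
    cases hp : s.parent with
    | none => simp [NodeState.optReg]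
    | some p => exact (size_succ_le p).trans (by have := hid' p (hs.parent p hp); omega)
  have httl : (NodeState.optReg s.ttl).size ≤ L + 6 := by
    cases hp : s.ttl with
    | none => simp [NodeState.optReg]
    | some p => exact hsmall _ (by have := hs.ttl p hp; show p + 1 ≤ _; omega)
  have hcount : (NodeState.optReg s.count).size ≤ L + 6 := by
    cases hp : s.count with
    | none => simp [NodeState.optReg]
    | some p => exact hsmall _ (by have := hc p hp; show p + 1 ≤ _; omega)
  have hcand : ∀ m ∈ NodeState.candRegs s.cand, m.size ≤ 2 * (k * L) + (L + 6) := by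
    intro m hm
    rcases hcd : s.cand with _ | e
    · rw [hcd] at hm
      simp only [NodeState.candRegs, List.mem_cons, List.not_mem_nil, or_false, or_self] at hm
      simp [hm]
    · rw [hcd] at hm
      obtain ⟨h1, h2, h3, h4⟩ := hs.cand e hcd
      simp only [NodeState.candRegs, List.mem_cons, List.not_mem_nil, or_false] at hm
      rcases hm with rfl | rfl | rfl | rfl | rfl
      · exact (hsmall 1 (by omega)).trans (by omega)
      · have := hweight _ h1; omega
      · have := hid' _ h2; omega
      · have := hid' _ h3; omega
      · have := hid' _ h4; omega
  have hregs : ∀ m ∈ s.regs, m.size ≤ 2 * (k * L) + (L + 6) := by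
    intro m hm
    unfold NodeState.regs at hm
    rw [List.mem_append] at hm
    rcases hm with hm | hm
    swap
    · exact hcand m hm
    simp only [List.mem_cons, List.not_mem_nil, or_false] at hm
    have h1 := hid' _ hs.id
    have h2 := hid' _ hs.rootId
    rcases hm with rfl | rfl | rfl | rfl | rfl | rfl | rfl | rfl | rfl | rfl | rfl | rfl | rfl
    · omega
    · omega
    · omega
    · omega
    · omega
    · omega
    · omega
    all_goals exact (hbool _).trans (by omega)
  refine (length_encode_le hregs).trans ?_
  -- With registers of size at most `C = 2 * (k * L) + L + 6` one has `2 * C + 1 = 4 * (k * L) + 2 *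
  -- L + 13`, and `13 ≤ 13 * L`.
  have : 18 * (4 * k + 15) * L = 72 * (k * L) + 270 * L := by ring
  omega

/-! ### Fragments -/

theorem clock_step (s : NodeState) (nb : Multiset Neighbour) (h : s.done = false) :
    (s.step nb).clock = s.clock + 1 := by
  unfold NodeState.step
  rw [if_neg (by simp [h])]
  dsimp only
  have key : ∀ s : NodeState, (∀ i, (s.startPhase i).clock = s.clock) ∧
      (s.countWave nb).clock = s.clock ∧ (∀ i, (s.countEcho i nb).clock = s.clock) ∧
      s.startFind.clock = s.clock ∧ (s.findWave nb).clock = s.clock ∧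
      (s.findLocal nb).clock = s.clock ∧ (s.findEcho nb).clock = s.clock ∧
      s.startTransfer.clock = s.clock ∧ (s.rootTransfer nb).clock = s.clock ∧
      (s.hook nb).clock = s.clock := by
    intro s
    refine ⟨fun i => ?_, ?_, fun i => ?_, ?_, ?_, ?_, ?_, ?_, ?_, ?_⟩
    · unfold NodeState.startPhase; dsimp only; split_ifs <;> rfl
    · unfold NodeState.countWave; repeat' split
      all_goals rfl
    · unfold NodeState.countEcho; dsimp only; split_ifs <;> rfl
    · unfold NodeState.startFind; split_ifs <;> rfl
    · unfold NodeState.findWave; repeat' split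
      all_goals rfl
    · unfold NodeState.findLocal; split_ifs <;> rfl
    · unfold NodeState.findEcho; split_ifs <;> rfl
    · unfold NodeState.startTransfer; split_ifs <;> rfl
    · unfold NodeState.rootTransfer; repeat' split
      all_goals rfl
    · unfold NodeState.hook; repeat' split
      all_goals rfl
  obtain ⟨h1, h2, h3, h4, h5, h6, h7, h8, h9, h10⟩ := key { s with clock := s.clock + 1 }
  have ite : ∀ {p : Prop} [Decidable p] {a b : NodeState} {m : ℕ}, a.clock = m → b.clock = m →
      (if p then a else b).clock = m := by
    intro p _ a b m ha hb
    split_ifs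
    · exact ha
    · exact hb
  exact ite rfl (ite rfl (ite (h1 _) (ite h2 (ite (h3 _) (ite h4 (ite h5 (ite h6 (ite h7
    (ite h8 (ite h9 h10))))))))))

section

variable [Fintype V] {t : ℕ} {F : Forest N}

theorem fragment_eq (h : F.Rep (N.run t)) {r : V} (hr : F.par r = none) :
    N.fragment t r = {v | F.rt v = F.rt r} := by
  ext v
  have : (fun a b => (N.run t a).parent = some (N.id b)) = fun a b => F.par a = some b := by
    ext a b; rw [h.parent_eq_some]
  show Relation.ReflTransGen _ v r ↔ _
  rw [this, Set.mem_ofPred_eq, F.rt_root hr]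
  exact F.desc_root_iff hr

theorem clock_of_not_done (N : Network V) (t : ℕ) (v : V) (h : (N.run t v).done = false) :
    (N.run t v).clock = t := by
  induction t generalizing v with
  | zero => rfl
  | succ t ih =>
    have hd : (N.run t v).done = false := by
      by_contra hn
      rw [Bool.not_eq_false] at hn
      rw [run_succ_of_done hn, hn] at h
      simp at h
    show ((N.run t v).step _).clock = _
    rw [clock_step _ _ hd, ih v hd]

/-- No invariant is needed. A node that has not terminated has the right clock, its parent cannot
have been done, and `startPhase` leaves pointers alone, so a root after this round was a root before
and has set its level. -/
theorem level_of_root (N : Network V) (i : ℕ) (r : V) (hr : N.IsRoot (11 * 2 ^ i) r)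
    (hd : (N.run (11 * 2 ^ i) r).done = false) : (N.run (11 * 2 ^ i) r).level = i := by
  have hP : 0 < 2 ^ i := by positivity
  obtain ⟨t, ht⟩ : ∃ t, t + 1 = 11 * 2 ^ i := ⟨11 * 2 ^ i - 1, by omega⟩
  unfold IsRoot at hr
  rw [← ht] at hr hd ⊢
  have hd' : (N.run t r).done = false := by
    by_contra hn
    rw [Bool.not_eq_false] at hn
    rw [run_succ_of_done hn, hn] at hd
    simp at hd
  have hpar : ((N.run t r).parentState (N.view (N.run t) r)).any (fun p => p.done) = false := by
    by_contra hn
    rw [Bool.not_eq_false] at hn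
    have : (N.run (t + 1) r).done = true := by
      show ((N.run t r).step _).done = true
      unfold NodeState.step
      rw [if_neg (by simp [hd'])]
      dsimp only
      rw [if_pos]
      exact hn
    rw [hd] at this
    simp at this
  have hrun := run_succ_of_not_done (i := i) hd' (N.clock_of_not_done t r hd') hpar (by omega)
    (by omega)
  dsimp only at hrun
  rw [if_pos ht] at hrun
  rw [hrun] at hr ⊢
  unfold NodeState.startPhase at hr ⊢
  dsimp only at hr ⊢
  split_ifs at hr ⊢ with h
  · rfl
  · exact absurd hr h

end

end Network

end SyncMST

/-! ### The main theorem -/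

open SyncMST in
theorem mainTheorem5 :
    ∃ A : ℕ, ∀ k : ℕ, ∃ B : ℕ, ∀ (V : Type*) [Fintype V] (N : Network V),
      (∀ t, A * Fintype.card V ≤ t →
        (∀ v, (N.run t v).done = true) ∧ N.IsMST (N.output t)) ∧
      ((∀ v, (N.id v).size ≤ k * (Nat.log 2 (Fintype.card V) + 1)) →
        (∀ e ∈ N.graph.edgeSet, N.weight e ≤ k * Fintype.card V ^ k) →
        ∀ t v, N.memory t v ≤ B * (Nat.log 2 (Fintype.card V) + 1)) ∧
      (∀ t v, ∃ r, N.IsRoot t r ∧ v ∈ N.fragment t r) ∧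
      (∀ t r, N.IsRoot t r → 2 ^ (N.run t r).level ≤ (N.fragment t r).ncard) ∧
      (∀ i r, N.IsRoot (11 * 2 ^ i) r → (N.run (11 * 2 ^ i) r).done = false →
        (N.run (11 * 2 ^ i) r).level = i) := by
  refine ⟨22, fun k => ⟨18 * (4 * k + 15), fun V _ N => ?_⟩⟩
  obtain ⟨hgood, T, hT, hfin⟩ := N.good_and_finished
  refine ⟨fun t ht => hfin t (by omega), fun hid hw t v => ?_, fun t v => ?_, fun t r hr => ?_,
    N.level_of_root⟩
  · have hn : 0 < Fintype.card V := Fintype.card_pos_iff.2 ⟨v⟩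
    have key : ∀ t ≤ 22 * Fintype.card V,
        N.memory t v ≤ (18 * (4 * k + 15)) * (Nat.log 2 (Fintype.card V) + 1) := by
      intro t ht
      obtain ⟨F, -, -, hc⟩ := hgood t
      exact Network.length_encode_le_of_within hn ((N.within_run t v).mono ht) (hc v) hid hw
    -- From round `T < 22 * n` on the memories, clocks included, are frozen, so the bound at `T`
    -- covers all later rounds.
    have hconst : ∀ j, N.run (T + j) v = N.run T v := by
      intro j
      induction j with
      | zero => rfl
      | succ j ih =>
        rw [← add_assoc, Network.run_succ_of_done ((hfin (T + j) (by omega)).1 v), ih]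
    rcases Nat.lt_or_ge t T with h | h
    · exact key t (by omega)
    · obtain ⟨j, rfl⟩ := Nat.exists_eq_add_of_le h
      have := key T (by omega)
      unfold Network.memory at this ⊢
      rwa [hconst]
  · obtain ⟨F, hF, -⟩ := hgood t
    refine ⟨F.rt v, hF.parent_eq_none.2 (F.par_rt v), ?_⟩
    rw [Network.fragment_eq hF (F.par_rt v), Set.mem_ofPred_eq, F.rt_rt]
  · obtain ⟨F, hF, hlev, -⟩ := hgood t
    have hr' : F.par r = none := hF.parent_eq_none.1 hr
    rw [Network.fragment_eq hF hr']
    exact hlev r hr'
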